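/- Let $r\ge 1$, $T>0$, let $f\colon\mathbb R^n\times[0,T]\to\mathbb R^n$ be of class $C^{r+1}$, let $\tilde B\in\mathbb R^{m\times n}$ have full row rank, let $\tilde g\in C^{r+2}([0,T];\mathbb R^m)$, and let $x_0\in\mathbb R^n$ be consistent, i.e. $\tilde Bx_0=\tilde g(0)$. Let $(x,\lambda)\colon[0,T]\to\mathbb R^n\times\mathbb R^m$ solve $$\dot x=f(x,t)-\tilde B^{\top}\lambda,\qquad 0=\tilde Bx-\tilde g(t),\qquad x(0)=x_0,$$ with $x\in C^{r+1}([0,T];\mathbb R^n)$. For $N\ge1$ put $\Delta=T/N$ and $I_\ell=[(\ell-1)\Delta,\ell\Delta]$, $\ell=1,\dots,N$. On each $I=I_\ell$ choose pairwise distinct points $t_0,\dots,t_r\in I$ (possibly different ones for different $\ell$) such that $t_0$ is the left and $t_r$ the right end point of $I$. Let $\varphi_0,\dots,\varphi_r$ be the Lagrange basis of the polynomials of degree at most $r$ for $t_0,\dots,t_r$, let $\psi_1,\dots,\psi_r$ be the Lagrange basis of the polynomials of degree at most $r-1$ for $t_1,\dots,t_r$, and set $D_{ij}=\int_I\dot\varphi_j\psi_i\,dt$,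 $M_{ij}=\int_I\varphi_j\psi_i\,dt$, and $$L_{r,\varphi}=\max_{t\in I}\sum_{j=0}^r|\varphi_j(t)|,\qquad L_{r,\psi}=\max_{t\in I}\sum_{i=1}^r|\psi_i(t)|.$$ The continuous Galerkin scheme of degree $r$ seeks, on each $I$, coefficients $x_0,\dots,x_r\in\mathbb R^n$ and $\lambda_1,\dots,\lambda_r\in\mathbb R^m$ with $$\sum_{j=0}^r x_jD_{ij}-\sum_{j=0}^r f(x_j,t_j)M_{ij}+\tilde B^\top\lambda_i=0,\qquad \tilde Bx_i=\tilde g(t_i),\qquad i=1,\dots,r,$$ where the coefficient $x_0$ on $I_1$ is the initial value, and on $I_\ell$, $\ell\ge2$, it is the coefficient $x_r$ of $I_{\ell-1}$. It defines on $I$ the polynomial $X=\sum_{j=0}^r x_j\varphi_j$ and the functional $\Lambda=\sum_{k=1}^r\lambda_k\delta_{t_k}$. For $k\in\{0,1,\dots\}\cup\{\infty\}$ let $\|v\|_{C^k(I)}=\sup_{j\le k,\,j<\infty}\sup_{t\in I}\|v^{(j)}(t)\|\in[0,\infty]$ and $$\|\lambda-\Lambda\|_{*,k,I}=\sup_{0\ne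 v\in C^\infty(I;\mathbb R^m)}\frac{\langle\lambda-\Lambda,v\rangle}{\|v\|_{C^k(I)}},\qquad \langle\lambda-\Lambda,v\rangle=\int_I\lambda(t)^\top v(t)\,dt-\sum_{k=1}^r\lambda_k^\top v(t_k)$$ (a quotient with infinite denominator is $0$, and the supremum of the empty set, which occurs only for $m=0$, is $0$). Then for all bounds $\bar L_\varphi,\bar L_\psi$ there is a constant $C>0$, depending on the points only through these bounds and not on $\Delta$, such that for every $R>\max_{[0,T]}\|x\|$ there is $\Delta_0>0$ with the following property. Whenever $\Delta=T/N\le\Delta_0$ and the points satisfy $L_{r,\varphi}\le\bar L_\varphi$ and $L_{r,\psi}\le\bar L_\psi$ on every $I_\ell$, the scheme has exactly one solution all of whose state coefficients $x_j$ (on all intervals) have norm at most $R$, and this solution satisfies $$\|x(t)-X(t)\|\le C\Delta^{r+1}\quad\text{for all }t\in[0,T],\qquad \|\lambda-\Lambda\|_{*,k,I_\ell}\le C\Delta^{r+1}\quad\text{for all }\ell=1,\dots,N\text{ and all }r\le k\le\infty;$$ in particular the second estimate holds for $k=\infty$. -/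

import Mathlib

open scoped ContDiff ENNReal

namespace CGDAE

noncomputable section

/-- `ℝⁿ` with the Euclidean norm. -/
abbrev Vec (n : ℕ) := EuclideanSpace ℝ (Fin n)

/-- Action of a matrix on Euclidean vectors. -/
def act {p q : ℕ} (A : Matrix (Fin p) (Fin q) ℝ) (v : Vec q) : Vec p :=
  WithLp.toLp 2 (A.mulVec v.ofLp)

/-- `(x, lam)` solves `x' = f(x,t) - Bᵀ lam`, `0 = B x - g(t)` on `[0,T]` with `x(0) = x0`
(one-sided derivatives at the two end points). -/
structure IsDAESolution {n m : ℕ} (T : ℝ) (f : Vec n → ℝ → Vec n)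
    (B : Matrix (Fin m) (Fin n) ℝ) (g : ℝ → Vec m) (x0 : Vec n)
    (x : ℝ → Vec n) (lam : ℝ → Vec m) : Prop where
  init : x 0 = x0
  ode : ∀ t ∈ Set.Icc 0 T,
    HasDerivWithinAt x (f (x t) t - act B.transpose (lam t)) (Set.Icc 0 T) t
  constraint : ∀ t ∈ Set.Icc 0 T, act B (x t) - g t = 0

/-- Admissible Lagrange points `t 0, …, t r` on `[a,b]`: pairwise distinct, with `t 0` and `t r`
the end points. -/
structure IsNodes {r : ℕ} (a b : ℝ) (t : Fin (r + 1) → ℝ) : Prop where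
  injective : Function.Injective t
  mem : ∀ j, t j ∈ Set.Icc a b
  left : t 0 = a
  right : t (Fin.last r) = b

/-- Lagrange basis of the polynomials of degree `≤ r` for the points `t 0, …, t r`. -/
def phi {r : ℕ} (t : Fin (r + 1) → ℝ) (j : Fin (r + 1)) : Polynomial ℝ :=
  Lagrange.basis Finset.univ t j

/-- Lagrange basis of the polynomials of degree `≤ r - 1` for the points `t 1, …, t r`.
The index `i : Fin r` stands for the point `t (i + 1)`. -/
def psi {r : ℕ} (t : Fin (r + 1) → ℝ) (i : Fin r) : Polynomial ℝ :=
  Lagrange.basis Finset.univ (fun k : Fin r => t k.succ) i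

/-- `D i j = ∫ φ_j' ψ_i` over `[a,b]`. -/
def matD {r : ℕ} (a b : ℝ) (t : Fin (r + 1) → ℝ) (i : Fin r) (j : Fin (r + 1)) : ℝ :=
  ∫ s in a..b, (phi t j).derivative.eval s * (psi t i).eval s

/-- `M i j = ∫ φ_j ψ_i` over `[a,b]`. -/
def matM {r : ℕ} (a b : ℝ) (t : Fin (r + 1) → ℝ) (i : Fin r) (j : Fin (r + 1)) : ℝ :=
  ∫ s in a..b, (phi t j).eval s * (psi t i).eval s

/-- Lebesgue constant of the points `t 0, …, t r` on `[a,b]`. -/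
def lebesguePhi {r : ℕ} (a b : ℝ) (t : Fin (r + 1) → ℝ) : ℝ :=
  sSup ((fun s => ∑ j, |(phi t j).eval s|) '' Set.Icc a b)

/-- Lebesgue constant of the points `t 1, …, t r` on `[a,b]`. -/
def lebesguePsi {r : ℕ} (a b : ℝ) (t : Fin (r + 1) → ℝ) : ℝ :=
  sSup ((fun s => ∑ i, |(psi t i).eval s|) '' Set.Icc a b)

/-- The grid point `ℓ Δ` of the uniform partition of `[0,T]` with step size `Δ = T / N`. -/
def grid (T : ℝ) (N ℓ : ℕ) : ℝ := ℓ * (T / N)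

/-- The continuous Galerkin scheme of degree `r` on the uniform partition of `[0,T]` into `N`
intervals: `X ℓ j` is the state at the Lagrange point `t ℓ j` of the `ℓ`-th interval (counted from
zero), and `L ℓ i` is the multiplier coefficient belonging to the point `t ℓ (i + 1)`. -/
structure IsCGSolution {n m r N : ℕ} (T : ℝ) (f : Vec n → ℝ → Vec n)
    (B : Matrix (Fin m) (Fin n) ℝ) (g : ℝ → Vec m) (x0 : Vec n)
    (t : Fin N → Fin (r + 1) → ℝ)
    (X : Fin N → Fin (r + 1) → Vec n) (L : Fin N → Fin r → Vec m) : Prop where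
  init : ∀ h : 0 < N, X ⟨0, h⟩ 0 = x0
  continuous : ∀ (ℓ : Fin N) (h : (ℓ : ℕ) + 1 < N), X ⟨ℓ + 1, h⟩ 0 = X ℓ (Fin.last r)
  galerkin : ∀ (ℓ : Fin N) (i : Fin r),
    ∑ j, matD (grid T N ℓ) (grid T N (ℓ + 1)) (t ℓ) i j • X ℓ j
      - ∑ j, matM (grid T N ℓ) (grid T N (ℓ + 1)) (t ℓ) i j • f (X ℓ j) (t ℓ j)
      + act B.transpose (L ℓ i) = 0
  constraint : ∀ (ℓ : Fin N) (k : Fin r), act B (X ℓ k.succ) - g (t ℓ k.succ) = 0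

/-- The polynomial `∑ j, x_j φ_j` evaluated at `s`. -/
def interp {n r : ℕ} (t : Fin (r + 1) → ℝ) (x : Fin (r + 1) → Vec n) (s : ℝ) : Vec n :=
  ∑ j, (phi t j).eval s • x j

/-- The norm of `C^k([a,b]; ℝᵐ)`, the supremum over `[a,b]` of all derivatives of order at most
`k`. For `k = ∞` the value may be `∞`. -/
def ckNorm {m : ℕ} (k : ℕ∞) (a b : ℝ) (v : ℝ → Vec m) : ℝ≥0∞ :=
  ⨆ (j : ℕ) (_ : (j : ℕ∞) ≤ k) (s : ℝ) (_ : s ∈ Set.Icc a b),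
    ‖iteratedDerivWithin j v (Set.Icc a b) s‖ₑ

/-- The value `⟨lam - Λ, v⟩` on `[a,b]`, where `Λ = ∑ k, L_k δ_{t (k + 1)}`. -/
def pairing {m r : ℕ} (a b : ℝ) (t : Fin (r + 1) → ℝ) (lam : ℝ → Vec m) (L : Fin r → Vec m)
    (v : ℝ → Vec m) : ℝ :=
  (∫ s in a..b, inner ℝ (lam s) (v s)) - ∑ k : Fin r, inner ℝ (L k) (v (t k.succ))

/-- The dual norm of `lam - Λ`: the supremum of `⟨lam - Λ, v⟩ / ‖v‖_{C^k}` over all smooth `v`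
on `[a,b]` that do not vanish identically there. (The set of these `v` is symmetric, so cutting
negative quotients off at zero does not change the supremum; the quotient is `0` if
`‖v‖_{C^k} = ∞`.) -/
def dualNorm {m r : ℕ} (k : ℕ∞) (a b : ℝ) (t : Fin (r + 1) → ℝ) (lam : ℝ → Vec m)
    (L : Fin r → Vec m) : ℝ≥0∞ :=
  ⨆ (v : ℝ → Vec m) (_ : ContDiffOn ℝ ∞ v (Set.Icc a b)) (_ : ∃ s ∈ Set.Icc a b, v s ≠ 0),
    ENNReal.ofReal (pairing a b t lam L v) / ckNorm k a b v

end

end CGDAE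

/-! Testing with functions in `kerB B` removes the multiplier, since the range of `Bᵀ` is orthogonal
to the kernel of `B`. All nodal errors lie in that kernel, so the error polynomial E satisfies ∫⟨E',
w⟩ = ∫⟨ρ, w⟩ for all kernel-valued w in the test space. Here ρ is the defect of the interpolated
right hand side plus x' - (Ix)', with I the nodal interpolation (`integral_inner_error`). Since E'
has degree at most r - 1, it is itself a test function, and w = E' bounds E - E(a) by (b - a) sup
‖ρ‖ (`norm_interp_sub_le`).

The part x' - (Ix)' is only O(Δ^r), which would cost an order when summed over T/Δ intervals. But
both end points are nodes, so its integral over the interval vanishes. A constant test function then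
shows that the increment of E sees only the other part of ρ (`norm_error_step_le`), and a discrete
Gronwall argument gives O(Δ^(r+1)) at all nodes (`norm_node_error_le`).

For the multiplier, a left inverse A of `Bᵀ` that vanishes on the kernel of `B` expresses `lam`
through x' and Λ through the discrete derivative. It annihilates E', so only errors of order Δ^r
remain, and the interval length supplies the last factor Δ (`pairing_le`).

Since f is only locally Lipschitz, the scheme is first solved for a globally Lipschitz modification
agreeing with f on the ball of radius R, by a fixed point iteration over the linear one-step problem
(`exists_isStep`). For small Δ the error estimate places this solution in that ball and within
distance 1 of x. A second pass, with the Lipschitz constant of f on the ball of radius max ‖x‖ + 1,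
makes C independent of R. -/

namespace CGDAE

noncomputable section

/-! ### Interpolation error by repeated use of Rolle's theorem -/

/-- A derivative has a zero between any two consecutive zeros of the function. -/
theorem exists_strictMono_zeros_of_hasDerivWithinAt {a b : ℝ} {k : ℕ} {h h' : ℝ → ℝ}
    (hd : ∀ s ∈ Set.Icc a b, HasDerivWithinAt h (h' s) (Set.Icc a b) s)
    {z : Fin (k + 1) → ℝ} (hz : StrictMono z) (hzm : ∀ i, z i ∈ Set.Icc a b)
    (hz0 : ∀ i, h (z i) = 0) :
    ∃ c : Fin k → ℝ, StrictMono c ∧ (∀ i, c i ∈ Set.Icc a b) ∧ ∀ i, h' (c i) = 0 := by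
  have key : ∀ i : Fin k, ∃ c ∈ Set.Ioo (z i.castSucc) (z i.succ), h' c = 0 := by
    intro i
    have hlt : z i.castSucc < z i.succ := hz i.castSucc_lt_succ
    have hsub : Set.Icc (z i.castSucc) (z i.succ) ⊆ Set.Icc a b :=
      Set.Icc_subset_Icc (hzm _).1 (hzm _).2
    refine exists_hasDerivAt_eq_zero hlt
      (fun s hs => ((hd s (hsub hs)).continuousWithinAt).mono hsub)
      ((hz0 _).trans (hz0 _).symm) fun s hs => ?_
    refine (hd s (hsub (Set.Ioo_subset_Icc_self hs))).hasDerivAt (Icc_mem_nhds ?_ ?_)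
    · exact (hzm _).1.trans_lt hs.1
    · exact hs.2.trans_le (hzm _).2
  choose c hc hc0 using key
  refine ⟨c, fun i j hij => ?_, fun i => ?_, hc0⟩
  -- For i < j the chain is c i < z (i + 1) ≤ z j < c j.
  · exact ((hc i).2.trans_le (hz.monotone (by
      rw [Fin.le_def, Fin.val_succ, Fin.val_castSucc]; exact hij))).trans (hc j).1
  · exact ⟨(hzm _).1.trans (hc i).1.le, (hc i).2.le.trans (hzm _).2⟩

/-- If `h 0` has `k` zeros, `h (i + 1)` is the derivative of `h i`, and `h k` is bounded by `M`,
then `h i` is bounded by `M * (b - a) ^ (k - i)`. -/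
theorem abs_le_of_strictMono_zeros {a b M : ℝ} :
    ∀ (k : ℕ) (h : ℕ → ℝ → ℝ) (z : Fin k → ℝ), StrictMono z → (∀ i, z i ∈ Set.Icc a b) →
      (∀ i, h 0 (z i) = 0) →
      (∀ i < k, ∀ s ∈ Set.Icc a b, HasDerivWithinAt (h i) (h (i + 1) s) (Set.Icc a b) s) →
      (∀ s ∈ Set.Icc a b, |h k s| ≤ M) →
      ∀ i ≤ k, ∀ s ∈ Set.Icc a b, |h i s| ≤ M * (b - a) ^ (k - i) := by
  intro k
  induction k with
  | zero =>
    intro h z _ _ _ _ hM i hi s hs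
    obtain rfl : i = 0 := by omega
    simpa using hM s hs
  | succ k ih =>
    intro h z hz hzm hz0 hd hM
    obtain ⟨c, hc, hcm, hc0⟩ :=
      exists_strictMono_zeros_of_hasDerivWithinAt (hd 0 k.succ_pos) hz hzm hz0
    -- The shifted sequence starts with the derivative, whose k zeros come from Rolle's theorem.
    have hrec := ih (fun i => h (i + 1)) c hc hcm hc0 (fun i hi => hd (i + 1) (by omega)) hM
    intro i hi s hs
    rcases i with _ | i
    · have hmv := Convex.norm_image_sub_le_of_norm_hasDerivWithin_le (hd 0 k.succ_pos)
        (hrec 0 k.zero_le) (convex_Icc a b) (hzm 0) hs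
      rw [hz0 0, sub_zero, Real.norm_eq_abs, Real.norm_eq_abs] at hmv
      refine hmv.trans ?_
      have hab : 0 ≤ b - a := by linarith [hs.1, hs.2]
      have hM0 : 0 ≤ M := (abs_nonneg _).trans (hM s hs)
      have h1 : |s - z 0| ≤ b - a :=
        abs_sub_le_iff.2 ⟨by linarith [hs.2, (hzm 0).1], by linarith [hs.1, (hzm 0).2]⟩
      calc M * (b - a) ^ (k - 0) * |s - z 0| ≤ M * (b - a) ^ (k - 0) * (b - a) := by gcongr
        _ = M * (b - a) ^ (k + 1 - 0) := by simp only [Nat.sub_zero]; ring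
    · have := hrec i (by omega) s hs
      simpa [Nat.add_sub_add_right] using this

/-- Vector-valued version, with zeros in arbitrary order. -/
theorem norm_le_of_injective_zeros {E : Type*} [NormedAddCommGroup E] [InnerProductSpace ℝ E]
    {a b M : ℝ} {k : ℕ} (h : ℕ → ℝ → E) (τ : Fin k → ℝ) (hτ : Function.Injective τ)
    (hτm : ∀ i, τ i ∈ Set.Icc a b) (hτ0 : ∀ i, h 0 (τ i) = 0)
    (hd : ∀ i < k, ∀ s ∈ Set.Icc a b, HasDerivWithinAt (h i) (h (i + 1) s) (Set.Icc a b) s)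
    (hM : ∀ s ∈ Set.Icc a b, ‖h k s‖ ≤ M) {i : ℕ} (hi : i ≤ k) {s : ℝ} (hs : s ∈ Set.Icc a b) :
    ‖h i s‖ ≤ M * (b - a) ^ (k - i) := by
  classical
  have hcard : (Finset.univ.image τ).card = k := by
    rw [Finset.card_image_of_injective _ hτ, Finset.card_univ, Fintype.card_fin]
  set z := (Finset.univ.image τ).orderEmbOfFin hcard
  have hzτ : ∀ j, ∃ l, τ l = z j := fun j => by
    obtain ⟨l, -, hl⟩ := Finset.mem_image.1 (Finset.orderEmbOfFin_mem (Finset.univ.image τ) hcard j)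
    exact ⟨l, hl⟩
  have hab : 0 ≤ b - a := by linarith [hs.1, hs.2]
  have hM0 : 0 ≤ M := (norm_nonneg _).trans (hM s hs)
  -- Rolle's theorem is scalar, so everything is paired with the fixed vector `h i s`; its norm is
  -- divided out at the end.
  have key := abs_le_of_strictMono_zeros (a := a) (b := b) (M := ‖h i s‖ * M) k
    (fun j x => inner ℝ (h i s) (h j x)) z z.strictMono
    (fun j => by obtain ⟨l, hl⟩ := hzτ j; rw [← hl]; exact hτm l)
    (fun j => by obtain ⟨l, hl⟩ := hzτ j; simp only [← hl, hτ0, inner_zero_right])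
    (fun j hj x hx => by
      simpa using (hasDerivWithinAt_const x (Set.Icc a b) (h i s)).inner ℝ (hd j hj x hx))
    (fun x hx => (abs_real_inner_le_norm _ _).trans
      (mul_le_mul_of_nonneg_left (hM x hx) (norm_nonneg _))) i hi s hs
  rw [real_inner_self_eq_norm_sq, abs_of_nonneg (sq_nonneg _), sq, mul_assoc] at key
  rcases (norm_nonneg (h i s)).eq_or_lt with h0 | h0
  · rw [← h0]; positivity
  · exact le_of_mul_le_mul_left key h0

/-- Error of Lagrange interpolation of `u 0` at `k` points and of its derivatives, where
`u (i + 1)` is the derivative of `u i`. -/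
theorem norm_sub_lagrange_le {E : Type*} [NormedAddCommGroup E] [InnerProductSpace ℝ E]
    {a b M : ℝ} {k : ℕ} (u : ℕ → ℝ → E) (τ : Fin k → ℝ) (hτ : Function.Injective τ)
    (hτm : ∀ i, τ i ∈ Set.Icc a b)
    (hd : ∀ i < k, ∀ s ∈ Set.Icc a b, HasDerivWithinAt (u i) (u (i + 1) s) (Set.Icc a b) s)
    (hM : ∀ s ∈ Set.Icc a b, ‖u k s‖ ≤ M) {i : ℕ} (hi : i ≤ k) {s : ℝ} (hs : s ∈ Set.Icc a b) :
    ‖u i s - ∑ j, (Polynomial.derivative^[i] (Lagrange.basis Finset.univ τ j)).eval s •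
      u 0 (τ j)‖ ≤ M * (b - a) ^ (k - i) := by
  refine norm_le_of_injective_zeros (fun i s => u i s -
    ∑ j, (Polynomial.derivative^[i] (Lagrange.basis Finset.univ τ j)).eval s • u 0 (τ j))
    τ hτ hτm (fun l => ?_) (fun i hi s hs => ?_) (fun s hs => ?_) hi hs
  · simp only [Function.iterate_zero, id_eq]
    rw [Finset.sum_eq_single l, Lagrange.eval_basis_self hτ.injOn (Finset.mem_univ l), one_smul,
      sub_self]
    · intro j _ hj
      rw [Lagrange.eval_basis_of_ne hj (Finset.mem_univ l), zero_smul]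
    · simp
  · refine (hd i hi s hs).sub (HasDerivWithinAt.fun_sum fun j _ => ?_)
    rw [Function.iterate_succ_apply']
    exact ((Polynomial.hasDerivAt _ s).smul_const _).hasDerivWithinAt
  -- The interpolant has degree below k, so the k-th derivative of the error is that of `u 0`.
  · have hzero : ∀ j, Polynomial.derivative^[k] (Lagrange.basis Finset.univ τ j) = 0 := by
      intro j
      apply Polynomial.iterate_derivative_eq_zero
      have hdeg := Lagrange.degree_basis (s := Finset.univ) (v := τ) hτ.injOn (Finset.mem_univ j)
      rw [Polynomial.natDegree_eq_of_degree_eq_some hdeg, Finset.card_univ, Fintype.card_fin]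
      have := j.pos
      omega
    simpa [hzero] using hM s hs

/-- The iterated derivatives within a set are derivatives of each other. -/
theorem hasDerivWithinAt_iteratedDerivWithin {E : Type*} [NormedAddCommGroup E]
    [NormedSpace ℝ E] {u : ℝ → E} {S : Set ℝ} {k : WithTop ℕ∞} (hu : ContDiffOn ℝ k u S)
    (hS : UniqueDiffOn ℝ S) {i : ℕ} (hi : (i : WithTop ℕ∞) < k) {s : ℝ} (hs : s ∈ S) :
    HasDerivWithinAt (iteratedDerivWithin i u S) (iteratedDerivWithin (i + 1) u S s) S s := by
  rw [iteratedDerivWithin_succ]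
  exact (hu.differentiableOn_iteratedDerivWithin hi hS s hs).hasDerivWithinAt

/-- A `C^k` function on a compact interval has a bounded `k`-th derivative. -/
theorem exists_norm_iteratedDerivWithin_le {E : Type*} [NormedAddCommGroup E]
    [NormedSpace ℝ E] {u : ℝ → E} {a b : ℝ} (hab : a < b) {k : ℕ}
    (hu : ContDiffOn ℝ k u (Set.Icc a b)) :
    ∃ M, 0 ≤ M ∧ ∀ s ∈ Set.Icc a b, ‖iteratedDerivWithin k u (Set.Icc a b) s‖ ≤ M := by
  obtain ⟨M, hM⟩ := isCompact_Icc.exists_bound_of_continuousOn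
    (hu.continuousOn_iteratedDerivWithin le_rfl (uniqueDiffOn_Icc hab))
  exact ⟨M, (norm_nonneg _).trans (hM a (Set.left_mem_Icc.2 hab.le)), hM⟩

/-! ### The Lagrange bases on one interval -/

section Basis

variable {r : ℕ} {a b : ℝ} {t : Fin (r + 1) → ℝ}

theorem IsNodes.le (ht : IsNodes a b t) : a ≤ b := (ht.mem 0).1.trans (ht.mem 0).2

theorem phi_eval_node (ht : IsNodes a b t) (i j : Fin (r + 1)) :
    (phi t j).eval (t i) = if i = j then 1 else 0 := by
  split_ifs with h
  · subst h
    exact Lagrange.eval_basis_self ht.injective.injOn (Finset.mem_univ _)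
  · exact Lagrange.eval_basis_of_ne (Ne.symm h) (Finset.mem_univ _)

theorem sum_abs_phi_le (a b : ℝ) (t : Fin (r + 1) → ℝ) {s : ℝ} (hs : s ∈ Set.Icc a b) :
    ∑ j, |(phi t j).eval s| ≤ lebesguePhi a b t := by
  refine le_csSup (isCompact_Icc.image_of_continuousOn ?_).bddAbove ⟨s, hs, rfl⟩
  exact (continuous_finsetSum _ fun j _ => ((phi t j).continuous).abs).continuousOn

theorem sum_abs_psi_le (a b : ℝ) (t : Fin (r + 1) → ℝ) {s : ℝ} (hs : s ∈ Set.Icc a b) :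
    ∑ j, |(psi t j).eval s| ≤ lebesguePsi a b t := by
  refine le_csSup (isCompact_Icc.image_of_continuousOn ?_).bddAbove ⟨s, hs, rfl⟩
  exact (continuous_finsetSum _ fun j _ => ((psi t j).continuous).abs).continuousOn

theorem succ_injective_nodes (ht : IsNodes a b t) :
    Function.Injective fun k : Fin r => t k.succ :=
  ht.injective.comp (Fin.succ_injective r)

theorem sum_psi_eval (hr : 1 ≤ r) (ht : IsNodes a b t) (s : ℝ) :
    ∑ i, (psi t i).eval s = 1 := by
  have : Nonempty (Fin r) := ⟨⟨0, hr⟩⟩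
  have := Lagrange.sum_basis (s := Finset.univ) (succ_injective_nodes ht).injOn
    Finset.univ_nonempty
  rw [← Polynomial.eval_finsetSum]
  simp only [psi, this, Polynomial.eval_one]

/-- The derivative of `phi t j` has degree at most r - 1, so it is its own interpolant at the r
points `t 1, …, t r`. -/
theorem sum_psi_eval_derivative_phi (ht : IsNodes a b t) (j : Fin (r + 1)) (s : ℝ) :
    ∑ i, (psi t i).eval s * (phi t j).derivative.eval (t i.succ)
      = (phi t j).derivative.eval s := by
  have hdeg : (phi t j).derivative.degree < (Finset.univ : Finset (Fin r)).card := by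
    have h1 : (phi t j).degree = ((r + 1 - 1 : ℕ) : WithBot ℕ) := by
      have := Lagrange.degree_basis (s := Finset.univ) (v := t) ht.injective.injOn
        (Finset.mem_univ j)
      rwa [Finset.card_univ, Fintype.card_fin] at this
    rw [Finset.card_univ, Fintype.card_fin]
    have h2 : phi t j ≠ 0 := fun h => by simp [h] at h1
    have := Polynomial.degree_derivative_lt h2
    simpa [h1] using this
  have h := Lagrange.eq_interpolate (s := Finset.univ) (succ_injective_nodes ht).injOn hdeg
  conv_rhs => rw [h, Lagrange.interpolate_apply]
  rw [Polynomial.eval_finsetSum]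
  refine Finset.sum_congr rfl fun i _ => ?_
  simp [psi, mul_comm]

end Basis

/-! ### Testing the scheme on one interval -/

section Testing

variable {n r : ℕ} {a b : ℝ} {t : Fin (r + 1) → ℝ}

/-- The derivative of `interp t x`. -/
def interpDeriv (t : Fin (r + 1) → ℝ) (x : Fin (r + 1) → Vec n) (s : ℝ) : Vec n :=
  ∑ j, (phi t j).derivative.eval s • x j

/-- The polynomial `∑ i, w_i ψ_i` evaluated at `s`. -/
def testFn (t : Fin (r + 1) → ℝ) (w : Fin r → Vec n) (s : ℝ) : Vec n :=
  ∑ i, (psi t i).eval s • w i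

theorem hasDerivAt_interp (t : Fin (r + 1) → ℝ) (x : Fin (r + 1) → Vec n) (s : ℝ) :
    HasDerivAt (interp t x) (interpDeriv t x s) s :=
  HasDerivAt.fun_sum fun j _ => ((phi t j).hasDerivAt s).smul_const (x j)

theorem continuous_interp (t : Fin (r + 1) → ℝ) (x : Fin (r + 1) → Vec n) :
    Continuous (interp t x) :=
  continuous_finsetSum _ fun j _ => (phi t j).continuous.smul continuous_const

theorem continuous_interpDeriv (t : Fin (r + 1) → ℝ) (x : Fin (r + 1) → Vec n) :
    Continuous (interpDeriv t x) :=
  continuous_finsetSum _ fun j _ => (phi t j).derivative.continuous.smul continuous_const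

theorem continuous_testFn (t : Fin (r + 1) → ℝ) (w : Fin r → Vec n) :
    Continuous (testFn t w) :=
  continuous_finsetSum _ fun j _ => (psi t j).continuous.smul continuous_const

theorem interp_sub (t : Fin (r + 1) → ℝ) (x y : Fin (r + 1) → Vec n) (s : ℝ) :
    interp t (x - y) s = interp t x s - interp t y s := by
  simp [interp, smul_sub]

theorem interpDeriv_sub (t : Fin (r + 1) → ℝ) (x y : Fin (r + 1) → Vec n) (s : ℝ) :
    interpDeriv t (x - y) s = interpDeriv t x s - interpDeriv t y s := by
  simp [interpDeriv, smul_sub]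

theorem interp_node (ht : IsNodes a b t) (x : Fin (r + 1) → Vec n) (i : Fin (r + 1)) :
    interp t x (t i) = x i := by
  simp [interp, phi_eval_node ht]

theorem interpDeriv_mem (K : Submodule ℝ (Vec n)) {x : Fin (r + 1) → Vec n}
    (hx : ∀ j, x j ∈ K) (s : ℝ) : interpDeriv t x s ∈ K :=
  K.sum_mem fun j _ => K.smul_mem _ (hx j)

theorem norm_interp_le {Lphi M : ℝ} (hL : lebesguePhi a b t ≤ Lphi) {x : Fin (r + 1) → Vec n}
    (hx : ∀ j, ‖x j‖ ≤ M) {s : ℝ} (hs : s ∈ Set.Icc a b) : ‖interp t x s‖ ≤ Lphi * M := by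
  have hM : 0 ≤ M := (norm_nonneg _).trans (hx 0)
  calc ‖interp t x s‖ ≤ ∑ j, |(phi t j).eval s| * M := by
        refine norm_sum_le_of_le _ fun j _ => ?_
        rw [norm_smul, Real.norm_eq_abs]
        exact mul_le_mul_of_nonneg_left (hx j) (abs_nonneg _)
    _ = (∑ j, |(phi t j).eval s|) * M := by rw [Finset.sum_mul]
    _ ≤ Lphi * M := mul_le_mul_of_nonneg_right ((sum_abs_phi_le a b t hs).trans hL) hM

theorem norm_testFn_le {Lpsi M : ℝ} (hL : lebesguePsi a b t ≤ Lpsi) {w : Fin r → Vec n}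
    (hM : 0 ≤ M) (hw : ∀ j, ‖w j‖ ≤ M) {s : ℝ} (hs : s ∈ Set.Icc a b) :
    ‖testFn t w s‖ ≤ Lpsi * M := by
  calc ‖testFn t w s‖ ≤ ∑ j, |(psi t j).eval s| * M := by
        refine norm_sum_le_of_le _ fun j _ => ?_
        rw [norm_smul, Real.norm_eq_abs]
        exact mul_le_mul_of_nonneg_left (hw j) (abs_nonneg _)
    _ = (∑ j, |(psi t j).eval s|) * M := by rw [Finset.sum_mul]
    _ ≤ Lpsi * M := mul_le_mul_of_nonneg_right ((sum_abs_psi_le a b t hs).trans hL) hM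

/-- This makes the derivative of a trial function an admissible test function, as the energy
estimate requires. -/
theorem testFn_interpDeriv (ht : IsNodes a b t) (e : Fin (r + 1) → Vec n) (s : ℝ) :
    testFn t (fun i => interpDeriv t e (t i.succ)) s = interpDeriv t e s := by
  simp only [testFn, interpDeriv, Finset.smul_sum, smul_smul]
  rw [Finset.sum_comm]
  refine Finset.sum_congr rfl fun j _ => ?_
  rw [← Finset.sum_smul, sum_psi_eval_derivative_phi ht]

theorem testFn_const (hr : 1 ≤ r) (ht : IsNodes a b t) (u : Vec n) (s : ℝ) :
    testFn t (fun _ => u) s = u := by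
  rw [testFn, ← Finset.sum_smul, sum_psi_eval hr ht, one_smul]

/-- Passage from the coefficient equations to the weak form; q is the family of the φ_j or of their
derivatives. -/
theorem sum_inner_integral_smul (q : Fin (r + 1) → Polynomial ℝ) (e : Fin (r + 1) → Vec n)
    (w : Fin r → Vec n) :
    ∑ i, inner ℝ (∑ j, (∫ s in a..b, (q j).eval s * (psi t i).eval s) • e j) (w i)
      = ∫ s in a..b, inner ℝ (∑ j, (q j).eval s • e j) (testFn t w s) := by
  have hint : ∀ (i : Fin r) (j : Fin (r + 1)), IntervalIntegrable
      (fun s => (q j).eval s * (psi t i).eval s * inner ℝ (e j) (w i)) MeasureTheory.volume a b :=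
    fun i j => (((q j).continuous.mul (psi t i).continuous).mul
      continuous_const).intervalIntegrable _ _
  have hexp : ∀ s, inner ℝ (∑ j, (q j).eval s • e j) (testFn t w s)
      = ∑ i, ∑ j, (q j).eval s * (psi t i).eval s * inner ℝ (e j) (w i) := by
    intro s
    rw [testFn, inner_sum]
    refine Finset.sum_congr rfl fun i _ => ?_
    rw [sum_inner]
    refine Finset.sum_congr rfl fun j _ => ?_
    rw [real_inner_smul_left, real_inner_smul_right, mul_assoc]
  simp only [hexp]
  rw [intervalIntegral.integral_finsetSum fun i _ => by
    simpa only [Finset.sum_fn] using IntervalIntegrable.sum Finset.univ fun j _ => hint i j]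
  refine Finset.sum_congr rfl fun i _ => ?_
  rw [intervalIntegral.integral_finsetSum fun j _ => hint i j, sum_inner]
  refine Finset.sum_congr rfl fun j _ => ?_
  rw [intervalIntegral.integral_mul_const, real_inner_smul_left]

theorem sum_inner_matD (e : Fin (r + 1) → Vec n) (w : Fin r → Vec n) :
    ∑ i, inner ℝ (∑ j, matD a b t i j • e j) (w i)
      = ∫ s in a..b, inner ℝ (interpDeriv t e s) (testFn t w s) :=
  sum_inner_integral_smul (fun j => (phi t j).derivative) e w

theorem sum_inner_matM (c : Fin (r + 1) → Vec n) (w : Fin r → Vec n) :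
    ∑ i, inner ℝ (∑ j, matM a b t i j • c j) (w i)
      = ∫ s in a..b, inner ℝ (interp t c s) (testFn t w s) :=
  sum_inner_integral_smul (phi t) c w

/-- Energy estimate: test with the derivative of the discrete solution. -/
theorem norm_interp_sub_le (ht : IsNodes a b t) (K : Submodule ℝ (Vec n))
    {e : Fin (r + 1) → Vec n} (he : ∀ j, e j ∈ K) {ρ : ℝ → Vec n}
    (hρ : ContinuousOn ρ (Set.Icc a b)) {M : ℝ} (hM : ∀ s ∈ Set.Icc a b, ‖ρ s‖ ≤ M)
    (heq : ∀ w : Fin r → Vec n, (∀ i, w i ∈ K) →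
      ∫ s in a..b, inner ℝ (interpDeriv t e s) (testFn t w s)
        = ∫ s in a..b, inner ℝ (ρ s) (testFn t w s))
    {s : ℝ} (hs : s ∈ Set.Icc a b) : ‖interp t e s - e 0‖ ≤ (b - a) * M := by
  have hab := ht.le
  have hM0 : 0 ≤ M := (norm_nonneg _).trans (hM s hs)
  have hcE := continuous_interpDeriv t e
  -- With E the interpolant of `e`, the test function is E' itself, so ∫‖E'‖² = ∫⟨ρ, E'⟩.
  have htest := heq (fun i => interpDeriv t e (t i.succ)) fun i => interpDeriv_mem K he _
  simp only [testFn_interpDeriv ht, real_inner_self_eq_norm_sq] at htest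
  set J := ∫ s in a..b, ‖interpDeriv t e s‖ with hJ
  have hnormint : ∀ c d : ℝ, IntervalIntegrable (fun s => ‖interpDeriv t e s‖)
      MeasureTheory.volume c d := fun c d => hcE.norm.intervalIntegrable c d
  have hJle : ∫ s in a..b, inner ℝ (ρ s) (interpDeriv t e s) ≤ M * J := by
    rw [hJ, ← intervalIntegral.integral_const_mul]
    refine intervalIntegral.integral_mono_on hab ?_ ((hnormint a b).const_mul M) fun x hx => ?_
    · refine ContinuousOn.intervalIntegrable ?_
      rw [Set.uIcc_of_le hab]
      exact hρ.inner hcE.continuousOn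
    · exact (real_inner_le_norm _ _).trans
        (mul_le_mul_of_nonneg_right (hM x hx) (norm_nonneg _))
  -- Young's inequality 2(M + δ)‖E'‖ ≤ ‖E'‖² + (M + δ)² stands in for Cauchy–Schwarz; δ makes the
  -- divisor positive even if M = 0.
  have hJbound : ∀ δ, 0 < δ → J ≤ (b - a) * (M + δ) := by
    intro δ hδ
    have hpos : 0 < M + δ := by linarith
    have hJ0 : 0 ≤ J := intervalIntegral.integral_nonneg hab fun x _ => norm_nonneg _
    have hamgm : ∫ s in a..b, 2 * (M + δ) * ‖interpDeriv t e s‖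
        ≤ ∫ s in a..b, (‖interpDeriv t e s‖ ^ 2 + (M + δ) ^ 2) := by
      refine intervalIntegral.integral_mono_on hab ((hnormint a b).const_mul _)
        (((hcE.norm.pow 2).add continuous_const).intervalIntegrable a b) fun x _ => ?_
      nlinarith [sq_nonneg (‖interpDeriv t e x‖ - (M + δ))]
    have hsq : IntervalIntegrable (fun s => ‖interpDeriv t e s‖ ^ 2) MeasureTheory.volume a b :=
      (hcE.norm.pow 2).intervalIntegrable a b
    rw [intervalIntegral.integral_const_mul, ← hJ,
      intervalIntegral.integral_add hsq intervalIntegrable_const, intervalIntegral.integral_const, smul_eq_mul, htest] at hamgm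
    have : (M + δ) * J ≤ (M + δ) * ((b - a) * (M + δ)) := by nlinarith
    exact le_of_mul_le_mul_left this hpos
  have hJfin : J ≤ (b - a) * M := by
    refine le_of_forall_pos_le_add fun ε hε => ?_
    -- δ = ε / (b - a + 1) gives (b - a)δ ≤ ε, also in the case a = b.
    have hd : 0 < ε / (b - a + 1) := by have : 0 ≤ b - a := by linarith
                                        positivity
    refine (hJbound _ hd).trans ?_
    have h1 : (b - a) * (ε / (b - a + 1)) ≤ ε := by
      rw [mul_div_assoc', div_le_iff₀ (by linarith)]
      nlinarith
    linarith [mul_add (b - a) M (ε / (b - a + 1))]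
  have hftc : ∫ y in a..s, interpDeriv t e y = interp t e s - e 0 := by
    rw [intervalIntegral.integral_eq_sub_of_hasDerivAt (fun y _ => hasDerivAt_interp t e y)
      (hcE.intervalIntegrable _ _)]
    congr 1
    rw [← ht.left, interp_node ht]
  rw [← hftc]
  refine (intervalIntegral.norm_integral_le_integral_norm hs.1).trans (le_trans ?_ hJfin)
  exact intervalIntegral.integral_mono_interval le_rfl hs.1 hs.2
    (Filter.Eventually.of_forall fun _ => norm_nonneg _) (hnormint a b)

/-- Testing with a constant gives the increment over the interval. -/
theorem inner_increment (hr : 1 ≤ r) (ht : IsNodes a b t) {e : Fin (r + 1) → Vec n}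
    {ρ : ℝ → Vec n} {u : Vec n}
    (heq : ∫ s in a..b, inner ℝ (interpDeriv t e s) (testFn t (fun _ => u) s)
        = ∫ s in a..b, inner ℝ (ρ s) (testFn t (fun _ => u) s)) :
    inner ℝ (e (Fin.last r) - e 0) u = ∫ s in a..b, inner ℝ (ρ s) u := by
  simp only [testFn_const hr ht] at heq
  rw [← heq]
  have hd : ∀ s, HasDerivAt (fun s => inner ℝ (interp t e s) u)
      (inner ℝ (interpDeriv t e s) u) s := fun s => by
    simpa using (hasDerivAt_interp t e s).inner ℝ (hasDerivAt_const s u)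
  rw [intervalIntegral.integral_eq_sub_of_hasDerivAt (fun s _ => hd s)
    (((continuous_interpDeriv t e).inner continuous_const).intervalIntegrable _ _),
    ← inner_sub_left]
  have h0 : interp t e a = e 0 := by rw [← interp_node ht e 0, ht.left]
  have h1 : interp t e b = e (Fin.last r) := by rw [← interp_node ht e (Fin.last r), ht.right]
  rw [h0, h1]

end Testing

/-! ### The constraint matrix -/

section Constraint

variable {n m : ℕ}

theorem inner_act_transpose (B : Matrix (Fin m) (Fin n) ℝ) (l : Vec m) (u : Vec n) :
    inner ℝ (act B.transpose l) u = inner ℝ l (act B u) := by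
  simp only [act, EuclideanSpace.inner_eq_star_dotProduct, star_trivial]
  rw [Matrix.mulVec_transpose, dotProduct_comm, ← Matrix.dotProduct_mulVec, dotProduct_comm]

/-- The kernel of the constraint matrix. -/
def kerB (B : Matrix (Fin m) (Fin n) ℝ) : Submodule ℝ (Vec n) :=
  LinearMap.ker (Matrix.toEuclideanLin B)

theorem mem_kerB {B : Matrix (Fin m) (Fin n) ℝ} {u : Vec n} : u ∈ kerB B ↔ act B u = 0 :=
  Iff.rfl

theorem act_sub (B : Matrix (Fin m) (Fin n) ℝ) (u v : Vec n) :
    act B (u - v) = act B u - act B v :=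
  map_sub (Matrix.toEuclideanLin B) u v

theorem act_transpose_injective {B : Matrix (Fin m) (Fin n) ℝ} (hB : B.rank = m) :
    Function.Injective (act B.transpose) := by
  have hrows : LinearIndependent ℝ B.row := by
    rw [linearIndependent_iff_card_eq_finrank_span, Set.finrank, ← Matrix.rank_eq_finrank_span_row, hB,
      Fintype.card_fin]
  intro l l' h
  have hvec : B.transpose.mulVec l.ofLp = B.transpose.mulVec l'.ofLp := congrArg WithLp.ofLp h
  rw [Matrix.mulVec_transpose, Matrix.mulVec_transpose] at hvec
  exact WithLp.ofLp_injective 2 (Matrix.vecMul_injective_iff.2 hrows hvec)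

/-- A left inverse of `Bᵀ` that vanishes on the kernel of `B`. -/
theorem exists_leftInverse_act_transpose {B : Matrix (Fin m) (Fin n) ℝ} (hB : B.rank = m) :
    ∃ A : Vec n →L[ℝ] Vec m, (∀ l, A (act B.transpose l) = l) ∧ ∀ u ∈ kerB B, A u = 0 := by
  -- If B Bᵀ l = 0, then ‖Bᵀ l‖² = ⟨l, B Bᵀ l⟩ = 0, so l = 0. With S a left inverse of B Bᵀ, the map
  -- S B is the required one.
  have hker : LinearMap.ker
      ((Matrix.toEuclideanLin B).comp (Matrix.toEuclideanLin B.transpose)) = ⊥ := by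
    rw [LinearMap.ker_eq_bot']
    intro l hl
    have hl' : act B (act B.transpose l) = 0 := hl
    have h0 : inner ℝ (act B.transpose l) (act B.transpose l) = 0 := by
      rw [inner_act_transpose, hl', inner_zero_right]
    refine act_transpose_injective hB ((inner_self_eq_zero.1 h0).trans ?_)
    exact (map_zero (Matrix.toEuclideanLin B.transpose)).symm
  obtain ⟨S, hS⟩ := LinearMap.exists_leftInverse_of_injective _ hker
  refine ⟨LinearMap.toContinuousLinearMap (S.comp (Matrix.toEuclideanLin B)),
    fun l => LinearMap.congr_fun hS l, fun u hu => ?_⟩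
  have hu' : Matrix.toEuclideanLin B u = 0 := hu
  simp [hu']

end Constraint

/-! ### Unique solvability on one interval -/

section Step

variable {n m r : ℕ} {a b : ℝ} {t : Fin (r + 1) → ℝ}

/-- The equations of the scheme on the interval `[a,b]` with initial value `y`. -/
structure IsStep (a b : ℝ) (t : Fin (r + 1) → ℝ) (f : Vec n → ℝ → Vec n)
    (B : Matrix (Fin m) (Fin n) ℝ) (g : ℝ → Vec m) (y : Vec n)
    (X : Fin (r + 1) → Vec n) (L : Fin r → Vec m) : Prop where
  init : X 0 = y
  galerkin : ∀ i : Fin r, ∑ j, matD a b t i j • X j - ∑ j, matM a b t i j • f (X j) (t j)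
      + act B.transpose (L i) = 0
  constraint : ∀ k : Fin r, act B (X k.succ) - g (t k.succ) = 0

/-- Multipliers disappear when one tests with functions in the kernel of the constraint. -/
theorem integral_inner_of_galerkin {B : Matrix (Fin m) (Fin n) ℝ}
    {X c : Fin (r + 1) → Vec n} {L : Fin r → Vec m}
    (h : ∀ i : Fin r, ∑ j, matD a b t i j • X j - ∑ j, matM a b t i j • c j
      + act B.transpose (L i) = 0)
    (w : Fin r → Vec n) (hw : ∀ i, w i ∈ kerB B) :
    ∫ s in a..b, inner ℝ (interpDeriv t X s) (testFn t w s)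
      = ∫ s in a..b, inner ℝ (interp t c s) (testFn t w s) := by
  rw [← sum_inner_matD, ← sum_inner_matM]
  refine Finset.sum_congr rfl fun i _ => ?_
  have h1 : inner ℝ (act B.transpose (L i)) (w i) = 0 := by
    rw [inner_act_transpose, mem_kerB.1 (hw i), inner_zero_right]
  have h2 := congrArg (fun u => inner ℝ u (w i)) (h i)
  simp only [inner_add_left, inner_sub_left, inner_zero_left, h1] at h2
  linarith

/-- Two solutions of the linear one-step equations with the same data in the constraint. -/
theorem norm_sub_le_of_galerkin (ht : IsNodes a b t) {Lphi : ℝ} (hL : lebesguePhi a b t ≤ Lphi)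
    {B : Matrix (Fin m) (Fin n) ℝ} {X X' c c' : Fin (r + 1) → Vec n} {L L' : Fin r → Vec m}
    (h : ∀ i : Fin r, ∑ j, matD a b t i j • X j - ∑ j, matM a b t i j • c j
      + act B.transpose (L i) = 0)
    (h' : ∀ i : Fin r, ∑ j, matD a b t i j • X' j - ∑ j, matM a b t i j • c' j
      + act B.transpose (L' i) = 0)
    (h0 : X 0 = X' 0) (hcon : ∀ k : Fin r, act B (X k.succ) = act B (X' k.succ))
    {C : ℝ} (hC : ∀ j, ‖c j - c' j‖ ≤ C) (j : Fin (r + 1)) :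
    ‖X j - X' j‖ ≤ (b - a) * (Lphi * C) := by
  have hmem : ∀ j, (X - X') j ∈ kerB B := by
    intro j
    refine Fin.cases ?_ (fun k => ?_) j
    · rw [Pi.sub_apply, h0, sub_self]; exact (kerB B).zero_mem
    · rw [mem_kerB, Pi.sub_apply, act_sub, hcon k, sub_self]
  -- The difference is kernel-valued and starts at 0; its weak equation has the interpolant of `c -
  -- c'` on the right.
  have key := norm_interp_sub_le ht (kerB B) hmem (continuous_interp t (c - c')).continuousOn
    (M := Lphi * C) (fun s hs => norm_interp_le hL hC hs) (fun w hw => by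
      simp only [interpDeriv_sub, interp_sub, inner_sub_left]
      have hi : ∀ F : ℝ → Vec n, Continuous F → IntervalIntegrable
          (fun s => inner ℝ (F s) (testFn t w s)) MeasureTheory.volume a b := fun F hF =>
        (hF.inner (continuous_testFn t w)).intervalIntegrable a b
      rw [intervalIntegral.integral_sub (hi _ (continuous_interpDeriv t X))
          (hi _ (continuous_interpDeriv t X')),
        intervalIntegral.integral_sub (hi _ (continuous_interp t c)) (hi _ (continuous_interp t c')),
        integral_inner_of_galerkin h w hw, integral_inner_of_galerkin h' w hw]) (ht.mem j)
  rw [interp_node ht] at key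
  simpa [h0] using key

/-- The linear one-step operator on the unknowns of one interval. -/
def stepOperator (a b : ℝ) (t : Fin (r + 1) → ℝ) (B : Matrix (Fin m) (Fin n) ℝ) :
    ((Fin r → Vec n) × (Fin r → Vec m)) →ₗ[ℝ] ((Fin r → Vec n) × (Fin r → Vec m)) where
  toFun p := (fun i => ∑ j : Fin r, matD a b t i j.succ • p.1 j
      + Matrix.toEuclideanLin B.transpose (p.2 i), fun i => Matrix.toEuclideanLin B (p.1 i))
  map_add' p q := by
    ext1
    · funext i
      simp only [Prod.fst_add, Prod.snd_add, Pi.add_apply, smul_add, Finset.sum_add_distrib,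
        map_add]
      abel
    · funext i
      simp
  map_smul' c p := by
    ext1
    · funext i
      simp only [Prod.smul_fst, Prod.smul_snd, Pi.smul_apply, map_smul, smul_add,
        Finset.smul_sum, RingHom.id_apply]
      congr 1
      exact Finset.sum_congr rfl fun j _ => smul_comm _ _ _
    · funext i
      simp

/-- A kernel element is a solution with zero data. Comparison with the zero solution, where C = 0,
annihilates the states, and injectivity of `Bᵀ` then annihilates the multipliers. -/
theorem stepOperator_injective (ht : IsNodes a b t) {B : Matrix (Fin m) (Fin n) ℝ}
    (hB : B.rank = m) : Function.Injective (stepOperator a b t B) := by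
  rw [← LinearMap.ker_eq_bot, LinearMap.ker_eq_bot']
  rintro ⟨Z, L⟩ hp
  have h1 : ∀ i, ∑ j : Fin r, matD a b t i j.succ • Z j + act B.transpose (L i) = 0 :=
    fun i => congrFun (congrArg Prod.fst hp) i
  have h2 : ∀ i, act B (Z i) = 0 := fun i => congrFun (congrArg Prod.snd hp) i
  have hz : ∀ {p q : ℕ} (A : Matrix (Fin p) (Fin q) ℝ), act A 0 = 0 :=
    fun A => map_zero (Matrix.toEuclideanLin A)
  have key := norm_sub_le_of_galerkin ht le_rfl (B := B) (X := Fin.cons 0 Z) (X' := 0) (c := 0)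
    (c' := 0) (L := L) (L' := 0) (C := 0)
    (fun i => by simpa [Fin.sum_univ_succ] using h1 i) (fun i => by simp [hz])
    (by simp) (fun k => by simp [hz, h2]) (by simp)
  have hZ : Z = 0 := by
    funext k
    simpa using key k.succ
  subst hZ
  have hL : L = 0 := by
    funext i
    refine act_transpose_injective hB ?_
    have := h1 i
    simp only [Pi.zero_apply, smul_zero, Finset.sum_const_zero, zero_add] at this
    rw [this, Pi.zero_apply, hz]
  rw [hL]
  rfl

/-- Unique solvability of the linear equations on one interval: existence. -/
theorem exists_linear_step (ht : IsNodes a b t) {B : Matrix (Fin m) (Fin n) ℝ}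
    (hB : B.rank = m) (y : Vec n) (F : Fin r → Vec n) (γ : Fin r → Vec m) :
    ∃ (Z : Fin r → Vec n) (L : Fin r → Vec m),
      (∀ i : Fin r, ∑ j, matD a b t i j • (Fin.cons y Z : Fin (r + 1) → Vec n) j - F i
        + act B.transpose (L i) = 0) ∧ ∀ k : Fin r, act B (Z k) = γ k := by
  -- The system is square, so injectivity suffices. The known initial value contributes column 0 of
  -- D, moved to the right hand side.
  obtain ⟨⟨Z, L⟩, hp⟩ := LinearMap.injective_iff_surjective.1 (stepOperator_injective ht hB)
    (fun i => F i - matD a b t i 0 • y, γ)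
  refine ⟨Z, L, fun i => ?_, fun k => congrFun (congrArg Prod.snd hp) k⟩
  have h1 : ∑ j : Fin r, matD a b t i j.succ • Z j + act B.transpose (L i)
      = F i - matD a b t i 0 • y := congrFun (congrArg Prod.fst hp) i
  rw [Fin.sum_univ_succ]
  simp only [Fin.cons_zero, Fin.cons_succ]
  rw [eq_sub_iff_add_eq] at h1
  rw [← h1]
  abel

variable {f : Vec n → ℝ → Vec n} {B : Matrix (Fin m) (Fin n) ℝ} {g : ℝ → Vec m}

/-- The one-step equations have at most one solution if the step is small. -/
theorem IsStep.unique (ht : IsNodes a b t) (hB : B.rank = m) {Lphi K : ℝ}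
    (hL : lebesguePhi a b t ≤ Lphi)
    (hsmall : (b - a) * (Lphi * K) ≤ 1 / 2) {y : Vec n}
    {X X' : Fin (r + 1) → Vec n} {L L' : Fin r → Vec m}
    (hX : IsStep a b t f B g y X L) (hX' : IsStep a b t f B g y X' L')
    (hK : ∀ j, ‖f (X j) (t j) - f (X' j) (t j)‖ ≤ K * ‖X j - X' j‖) (hK0 : 0 ≤ K) :
    X = X' ∧ L = L' := by
  have hd : ∀ j, ‖X j - X' j‖ ≤ ‖X - X'‖ := fun j => norm_le_pi_norm (X - X') j
  have key := norm_sub_le_of_galerkin ht hL hX.galerkin hX'.galerkin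
    (hX.init.trans hX'.init.symm)
    (fun k => (sub_eq_zero.1 (hX.constraint k)).trans (sub_eq_zero.1 (hX'.constraint k)).symm)
    (C := K * ‖X - X'‖)
    (fun j => (hK j).trans (mul_le_mul_of_nonneg_left (hd j) hK0))
  have hle : ‖X - X'‖ ≤ 1 / 2 * ‖X - X'‖ := by
    rw [pi_norm_le_iff_of_nonneg (by positivity)]
    intro j
    refine (key j).trans ?_
    rw [← mul_assoc, ← mul_assoc, mul_assoc (b - a)]
    exact mul_le_mul_of_nonneg_right hsmall (norm_nonneg _)
  have hXX : X = X' := by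
    rw [← sub_eq_zero, ← norm_eq_zero]
    linarith [norm_nonneg (X - X')]
  subst hXX
  refine ⟨rfl, funext fun i => act_transpose_injective hB ?_⟩
  exact add_left_cancel ((hX.galerkin i).trans (hX'.galerkin i).symm)

/-- The one-step equations have a solution if `f` is Lipschitz in space and the step is small. -/
theorem exists_isStep (ht : IsNodes a b t) (hB : B.rank = m) {Lphi K : ℝ}
    (hL : lebesguePhi a b t ≤ Lphi) (hK0 : 0 ≤ K)
    (hK : ∀ j u v, ‖f u (t j) - f v (t j)‖ ≤ K * ‖u - v‖)
    (hsmall : (b - a) * (Lphi * K) ≤ 1 / 2) (y : Vec n) :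
    ∃ X L, IsStep a b t f B g y X L := by
  -- Picard iteration: Ψ Z solves the linear step with f frozen at Z. The smallness condition makes
  -- it a contraction in the maximum norm.
  choose Ψ Λ hΨ hcon using fun Z : Fin r → Vec n => exists_linear_step (a := a) (b := b) ht hB y
    (fun i => ∑ j, matM a b t i j • f ((Fin.cons y Z : Fin (r + 1) → Vec n) j) (t j))
    (fun k => g (t k.succ))
  have hcontr : ContractingWith (1 / 2) Ψ := by
    refine ⟨by norm_num, LipschitzWith.of_dist_le_mul fun Z Z' => ?_⟩
    rw [dist_eq_norm, dist_eq_norm]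
    have key := norm_sub_le_of_galerkin ht hL (hΨ Z) (hΨ Z') (by simp)
      (fun k => by simp [hcon]) (C := K * ‖Z - Z'‖) (fun j => by
        refine (hK j _ _).trans (mul_le_mul_of_nonneg_left ?_ hK0)
        refine Fin.cases ?_ (fun k => ?_) j
        · simp
        · simpa using norm_le_pi_norm (Z - Z') k)
    rw [pi_norm_le_iff_of_nonneg (by positivity)]
    intro k
    have := key k.succ
    simp only [Fin.cons_succ] at this
    refine this.trans ?_
    rw [← mul_assoc, ← mul_assoc, mul_assoc (b - a)]
    have h2 : ((1 / 2 : NNReal) : ℝ) = 1 / 2 := by push_cast; rfl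
    rw [h2]
    exact mul_le_mul_of_nonneg_right hsmall (norm_nonneg _)
  have hfix := hcontr.fixedPoint_isFixedPt
  set Z := ContractingWith.fixedPoint Ψ hcontr
  refine ⟨Fin.cons y Z, Λ Z, by simp, fun i => ?_, fun k => ?_⟩
  · have := hΨ Z i
    rwa [hfix] at this
  · have := hcon Z k
    rw [hfix] at this
    simp [this]

end Step

/-! ### Unique solvability of the scheme -/

section Scheme

variable {n m r N : ℕ} {T : ℝ} {f : Vec n → ℝ → Vec n} {B : Matrix (Fin m) (Fin n) ℝ}
  {g : ℝ → Vec m} {x0 : Vec n} {t : Fin N → Fin (r + 1) → ℝ}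

theorem IsCGSolution.isStep {X : Fin N → Fin (r + 1) → Vec n} {L : Fin N → Fin r → Vec m}
    (h : IsCGSolution T f B g x0 t X L) (ℓ : Fin N) :
    IsStep (grid T N ℓ) (grid T N (ℓ + 1)) (t ℓ) f B g (X ℓ 0) (X ℓ) (L ℓ) :=
  ⟨rfl, h.galerkin ℓ, h.constraint ℓ⟩

/-- A scheme that is solvable on every interval is solvable. -/
theorem exists_isCGSolution_of_isStep
    (h : ∀ (ℓ : Fin N) (y : Vec n), ∃ X L,
      IsStep (grid T N ℓ) (grid T N (ℓ + 1)) (t ℓ) f B g y X L) :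
    ∃ X L, IsCGSolution T f B g x0 t X L := by
  choose X L hXL using h
  -- `Y k` is the initial value on interval k; the value beyond N is arbitrary.
  let Y : ℕ → Vec n := fun k => Nat.rec x0
    (fun k y => if hk : k < N then X ⟨k, hk⟩ y (Fin.last r) else y) k
  refine ⟨fun ℓ => X ℓ (Y ℓ), fun ℓ => L ℓ (Y ℓ), fun h => (hXL _ _).init, fun ℓ h => ?_,
    fun ℓ => (hXL ℓ _).galerkin, fun ℓ => (hXL ℓ _).constraint⟩
  rw [(hXL _ _).init]
  change (if hk : (ℓ : ℕ) < N then X ⟨ℓ, hk⟩ (Y ℓ) (Fin.last r) else Y ℓ) = _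
  rw [dif_pos ℓ.isLt]

/-- A scheme that is uniquely solvable on every interval has at most one solution. -/
theorem IsCGSolution.unique {X X' : Fin N → Fin (r + 1) → Vec n} {L L' : Fin N → Fin r → Vec m}
    (hX : IsCGSolution T f B g x0 t X L) (hX' : IsCGSolution T f B g x0 t X' L')
    (h : ∀ ℓ : Fin N, X ℓ 0 = X' ℓ 0 → X ℓ = X' ℓ ∧ L ℓ = L' ℓ) : X = X' ∧ L = L' := by
  have key : ∀ (k : ℕ) (hk : k < N), X ⟨k, hk⟩ 0 = X' ⟨k, hk⟩ 0 := by
    intro k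
    induction k with
    | zero => intro hk; rw [hX.init hk, hX'.init hk]
    | succ k ih =>
      intro hk
      have hk' : k < N := by omega
      rw [hX.continuous ⟨k, hk'⟩ hk, hX'.continuous ⟨k, hk'⟩ hk, (h _ (ih hk')).1]
  exact ⟨funext fun ℓ => (h ℓ (key ℓ ℓ.isLt)).1, funext fun ℓ => (h ℓ (key ℓ ℓ.isLt)).2⟩

end Scheme

/-! ### The exact solution and its interpolation error -/

section Exact

variable {n m r : ℕ}

/-- What the error analysis uses of the exact solution: `xd` is the derivative of `x`, `F` is the
right hand side along the solution, and `Mx`, `MF` control the interpolation errors. -/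
structure IsExact (r : ℕ) (T : ℝ) (B : Matrix (Fin m) (Fin n) ℝ) (x xd F : ℝ → Vec n)
    (lam : ℝ → Vec m) (Mx MF : ℝ) : Prop where
  deriv : ∀ s ∈ Set.Icc 0 T, HasDerivWithinAt x (xd s) (Set.Icc 0 T) s
  ode : ∀ s ∈ Set.Icc 0 T, xd s = F s - act B.transpose (lam s)
  continuousOn_xd : ContinuousOn xd (Set.Icc 0 T)
  continuousOn_F : ContinuousOn F (Set.Icc 0 T)
  Mx_nonneg : 0 ≤ Mx
  MF_nonneg : 0 ≤ MF
  interp_x : ∀ (a b : ℝ) (t : Fin (r + 1) → ℝ), IsNodes a b t → Set.Icc a b ⊆ Set.Icc 0 T →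
    ∀ s ∈ Set.Icc a b, ‖x s - interp t (fun j => x (t j)) s‖ ≤ Mx * (b - a) ^ (r + 1)
  interp_xd : ∀ (a b : ℝ) (t : Fin (r + 1) → ℝ), IsNodes a b t → Set.Icc a b ⊆ Set.Icc 0 T →
    ∀ s ∈ Set.Icc a b, ‖xd s - interpDeriv t (fun j => x (t j)) s‖ ≤ Mx * (b - a) ^ r
  interp_F : ∀ (a b : ℝ) (t : Fin (r + 1) → ℝ), IsNodes a b t → Set.Icc a b ⊆ Set.Icc 0 T →
    ∀ s ∈ Set.Icc a b, ‖F s - interp t (fun j => F (t j)) s‖ ≤ MF * (b - a) ^ (r + 1)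

/-- M bounds the derivative of order r + 1 on [0,T]. The argument via zeros does not involve the
distances of the nodes, so one M serves all subintervals and all nodes. -/
theorem exists_norm_sub_interp_le {T : ℝ} (hT : 0 < T) {u : ℝ → Vec n}
    (hu : ContDiffOn ℝ (r + 1) u (Set.Icc 0 T)) :
    ∃ M, 0 ≤ M ∧ ∀ (a b : ℝ) (t : Fin (r + 1) → ℝ), IsNodes a b t →
      Set.Icc a b ⊆ Set.Icc 0 T → ∀ s ∈ Set.Icc a b,
      ‖u s - interp t (fun j => u (t j)) s‖ ≤ M * (b - a) ^ (r + 1) ∧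
      ‖derivWithin u (Set.Icc 0 T) s - interpDeriv t (fun j => u (t j)) s‖ ≤ M * (b - a) ^ r := by
  have hu' : ContDiffOn ℝ ((r + 1 : ℕ) : WithTop ℕ∞) u (Set.Icc 0 T) := by exact_mod_cast hu
  obtain ⟨M, hM0, hM⟩ := exists_norm_iteratedDerivWithin_le hT hu'
  refine ⟨M, hM0, fun a b t ht hsub s hs => ?_⟩
  have key := fun i hi => norm_sub_lagrange_le (i := i)
    (fun i => iteratedDerivWithin i u (Set.Icc 0 T)) t
    ht.injective ht.mem (fun i hi s hs => (hasDerivWithinAt_iteratedDerivWithin hu'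
      (uniqueDiffOn_Icc hT) (by exact_mod_cast hi) (hsub hs)).mono hsub)
    (fun s hs => hM s (hsub hs)) hi hs
  constructor
  · simpa [interp, phi] using key 0 (by omega)
  · simpa [interpDeriv, phi, iteratedDerivWithin_one] using key 1 (by omega)

theorem exists_isExact {T : ℝ} (hT : 0 < T) {f : Vec n → ℝ → Vec n}
    (hf : ContDiffOn ℝ (r + 1) (fun p : Vec n × ℝ => f p.1 p.2) (Set.univ ×ˢ Set.Icc 0 T))
    {B : Matrix (Fin m) (Fin n) ℝ} {g : ℝ → Vec m} {x0 : Vec n} {x : ℝ → Vec n} {lam : ℝ → Vec m}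
    (hsol : IsDAESolution T f B g x0 x lam) (hx : ContDiffOn ℝ (r + 1) x (Set.Icc 0 T)) :
    ∃ Mx MF, IsExact r T B x (derivWithin x (Set.Icc 0 T)) (fun s => f (x s) s) lam Mx MF := by
  have hF : ContDiffOn ℝ (r + 1) (fun s => f (x s) s) (Set.Icc 0 T) :=
    hf.comp (g := fun p : Vec n × ℝ => f p.1 p.2) (hx.prodMk contDiffOn_id)
      fun s hs => ⟨Set.mem_univ _, hs⟩
  obtain ⟨Mx, hMx0, hMx⟩ := exists_norm_sub_interp_le hT hx
  obtain ⟨MF, hMF0, hMF⟩ := exists_norm_sub_interp_le hT hF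
  have hderiv : ∀ s ∈ Set.Icc 0 T, derivWithin x (Set.Icc 0 T) s
      = f (x s) s - act B.transpose (lam s) := fun s hs =>
    (hsol.ode s hs).derivWithin (uniqueDiffOn_Icc hT s hs)
  refine ⟨Mx, MF, fun s hs => ?_, hderiv, ?_, hF.continuousOn, hMx0, hMF0,
    fun a b t ht hsub s hs => (hMx a b t ht hsub s hs).1,
    fun a b t ht hsub s hs => (hMx a b t ht hsub s hs).2,
    fun a b t ht hsub s hs => (hMF a b t ht hsub s hs).1⟩
  · rw [hderiv s hs]; exact hsol.ode s hs
  · exact hx.continuousOn_derivWithin (uniqueDiffOn_Icc hT) (by simp)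

end Exact

/-! ### Error propagation over one interval -/

section Local

variable {n m r : ℕ} {T a b : ℝ} {t : Fin (r + 1) → ℝ} {B : Matrix (Fin m) (Fin n) ℝ}
  {x xd F : ℝ → Vec n} {lam : ℝ → Vec m} {Mx MF Lphi K ε : ℝ}
  {X c : Fin (r + 1) → Vec n} {L : Fin r → Vec m}

/-- Defect of the interpolated right hand side. -/
theorem norm_interp_sub_rhs_le (hE : IsExact r T B x xd F lam Mx MF) (ht : IsNodes a b t)
    (hsub : Set.Icc a b ⊆ Set.Icc 0 T) (hL : lebesguePhi a b t ≤ Lphi) (hK0 : 0 ≤ K)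
    (hc : ∀ j, ‖c j - F (t j)‖ ≤ K * ‖X j - x (t j)‖)
    (hε : ∀ j, ‖X j - x (t j)‖ ≤ ε) {s : ℝ} (hs : s ∈ Set.Icc a b) :
    ‖interp t c s - F s‖ ≤ Lphi * (K * ε) + MF * (b - a) ^ (r + 1) := by
  have h1 : ‖interp t (c - fun j => F (t j)) s‖ ≤ Lphi * (K * ε) :=
    norm_interp_le hL (fun j => (hc j).trans (mul_le_mul_of_nonneg_left (hε j) hK0)) hs
  have h2 := hE.interp_F a b t ht hsub s hs
  rw [interp_sub] at h1
  calc ‖interp t c s - F s‖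
      = ‖(interp t c s - interp t (fun j => F (t j)) s)
          - (F s - interp t (fun j => F (t j)) s)‖ := by congr 1; abel
    _ ≤ _ := (norm_sub_le _ _).trans (add_le_add h1 h2)

/-- The discrete error equation. -/
theorem integral_inner_error (hE : IsExact r T B x xd F lam Mx MF) (hab : a ≤ b)
    (hsub : Set.Icc a b ⊆ Set.Icc 0 T)
    (hG : ∀ i : Fin r, ∑ j, matD a b t i j • X j - ∑ j, matM a b t i j • c j
      + act B.transpose (L i) = 0)
    (w : Fin r → Vec n) (hw : ∀ i, w i ∈ kerB B) :
    ∫ s in a..b, inner ℝ (interpDeriv t (X - fun j => x (t j)) s) (testFn t w s)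
      = ∫ s in a..b, inner ℝ ((interp t c s - F s) + (xd s - interpDeriv t (fun j => x (t j)) s))
          (testFn t w s) := by
  have hi : ∀ G : ℝ → Vec n, Continuous G → IntervalIntegrable
      (fun s => inner ℝ (G s) (testFn t w s)) MeasureTheory.volume a b := fun G hG' =>
    (hG'.inner (continuous_testFn t w)).intervalIntegrable a b
  have hrhs : ∫ s in a..b, inner ℝ
      ((interp t c s - F s) + (xd s - interpDeriv t (fun j => x (t j)) s)) (testFn t w s)
      = ∫ s in a..b, (inner ℝ (interp t c s) (testFn t w s)
        - inner ℝ (interpDeriv t (fun j => x (t j)) s) (testFn t w s)) := by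
    -- Here xd - F = -Bᵀ lam, which is orthogonal to kernel-valued test functions.
    refine intervalIntegral.integral_congr fun s hs => ?_
    rw [Set.uIcc_of_le hab] at hs
    have hker : testFn t w s ∈ kerB B :=
      (kerB B).sum_mem fun i _ => (kerB B).smul_mem _ (hw i)
    have h0 : inner ℝ (act B.transpose (lam s)) (testFn t w s) = 0 := by
      rw [inner_act_transpose, mem_kerB.1 hker, inner_zero_right]
    simp only [hE.ode s (hsub hs), inner_add_left, inner_sub_left, h0]
    ring
  rw [hrhs, intervalIntegral.integral_sub (hi _ (continuous_interp t c))
    (hi _ (continuous_interpDeriv t _)), ← integral_inner_of_galerkin hG w hw]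
  simp only [interpDeriv_sub, inner_sub_left]
  rw [intervalIntegral.integral_sub (hi _ (continuous_interpDeriv t X))
    (hi _ (continuous_interpDeriv t _))]

/-- Error propagation over one interval: bounds for all nodes, and a sharper one for the right
end point. -/
theorem norm_error_step_le (hr : 1 ≤ r) (hE : IsExact r T B x xd F lam Mx MF)
    (ht : IsNodes a b t) (hsub : Set.Icc a b ⊆ Set.Icc 0 T) (hbT : b - a ≤ T)
    (hL : lebesguePhi a b t ≤ Lphi) (hL0 : 0 ≤ Lphi) (hK0 : 0 ≤ K)
    (hsmall : (b - a) * (Lphi * K) ≤ 1 / 2)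
    (hG : ∀ i : Fin r, ∑ j, matD a b t i j • X j - ∑ j, matM a b t i j • c j
      + act B.transpose (L i) = 0)
    (hcon : ∀ j, act B (X j) = act B (x (t j)))
    (hc : ∀ j, ‖c j - F (t j)‖ ≤ K * ‖X j - x (t j)‖) :
    (∀ j, ‖X j - x (t j)‖ ≤ 2 * ‖X 0 - x (t 0)‖ + 2 * (MF * T + Mx) * (b - a) ^ (r + 1)) ∧
    ‖X (Fin.last r) - x (t (Fin.last r))‖ ≤ (1 + 2 * (Lphi * K) * (b - a)) * ‖X 0 - x (t 0)‖
      + (b - a) * ((2 * (Lphi * K) * (MF * T + Mx) + MF) * (b - a) ^ (r + 1)) := by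
  have hab := ht.le
  have hd0 : 0 ≤ b - a := by linarith
  have hMx := hE.Mx_nonneg
  have hMF := hE.MF_nonneg
  set e : Fin (r + 1) → Vec n := X - fun j => x (t j) with he
  have hej : ∀ j, X j - x (t j) = e j := fun j => rfl
  have hmem : ∀ j, e j ∈ kerB B := fun j => by
    rw [mem_kerB, ← hej, act_sub, hcon, sub_self]
  have hεle : ∀ j, ‖e j‖ ≤ ‖e‖ := norm_le_pi_norm e
  have hρ0 := fun s (hs : s ∈ Set.Icc a b) =>
    norm_interp_sub_rhs_le hE ht hsub hL hK0 hc hεle hs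
  have hη := hE.interp_xd a b t ht hsub
  have hcF : ContinuousOn (fun s => interp t c s - F s) (Set.Icc a b) :=
    (continuous_interp t c).continuousOn.sub (hE.continuousOn_F.mono hsub)
  have hcη : ContinuousOn (fun s => xd s - interpDeriv t (fun j => x (t j)) s) (Set.Icc a b) :=
    (hE.continuousOn_xd.mono hsub).sub (continuous_interpDeriv t _).continuousOn
  have hweak := integral_inner_error hE hab hsub hG
  -- The factor b - a from the energy estimate lifts the defect of order r to order r + 1.
  have hnode : ∀ j, ‖e j‖ ≤ ‖e 0‖ + (b - a) * (Lphi * (K * ‖e‖) + MF * (b - a) ^ (r + 1)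
      + Mx * (b - a) ^ r) := by
    intro j
    have h := norm_interp_sub_le ht (kerB B) hmem (hcF.add hcη)
      (fun s hs => (norm_add_le _ _).trans (add_le_add (hρ0 s hs) (hη s hs))) hweak (ht.mem j)
    rw [interp_node ht] at h
    linarith [norm_le_norm_add_norm_sub' (e j) (e 0)]
  -- The smallness condition absorbs half of ‖e‖ on the left, whence the factors 2.
  have hsup : ‖e‖ ≤ 2 * ‖e 0‖ + 2 * (MF * T + Mx) * (b - a) ^ (r + 1) := by
    have h1 : ‖e‖ ≤ ‖e 0‖ + (b - a) * (Lphi * (K * ‖e‖) + MF * (b - a) ^ (r + 1)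
        + Mx * (b - a) ^ r) := (pi_norm_le_iff_of_nonneg (by positivity)).2 hnode
    have h2 : (b - a) * (Lphi * K) * ‖e‖ ≤ 1 / 2 * ‖e‖ :=
      mul_le_mul_of_nonneg_right hsmall (norm_nonneg _)
    have h3 : (b - a) * (MF * (b - a) ^ (r + 1)) ≤ T * (MF * (b - a) ^ (r + 1)) :=
      mul_le_mul_of_nonneg_right hbT (by positivity)
    have h4 : (b - a) * (Mx * (b - a) ^ r) = Mx * (b - a) ^ (r + 1) := by ring
    linarith
  refine ⟨fun j => (hεle j).trans hsup, ?_⟩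
  simp only [hej]
  set u := e (Fin.last r) - e 0 with hu
  have humem : u ∈ kerB B := (kerB B).sub_mem (hmem _) (hmem _)
  have hinc := inner_increment hr ht (hweak (fun _ => u) fun _ => humem)
  -- The interpolation error of x vanishes at both end points, so its derivative has mean zero. This
  -- removes the only defect of order r.
  have hη0 : ∫ s in a..b, inner ℝ (xd s - interpDeriv t (fun j => x (t j)) s) u = 0 := by
    have hder : ∀ s ∈ Set.Icc a b, HasDerivWithinAt
        (fun s => inner ℝ (x s - interp t (fun j => x (t j)) s) u)
        (inner ℝ (xd s - interpDeriv t (fun j => x (t j)) s) u) (Set.Icc a b) s := fun s hs => by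
      simpa using (((hE.deriv s (hsub hs)).mono hsub).sub
        (hasDerivAt_interp t (fun j => x (t j)) s).hasDerivWithinAt).inner ℝ
        (hasDerivWithinAt_const s (Set.Icc a b) u)
    rw [intervalIntegral.integral_eq_sub_of_hasDerivAt_of_le hab
      (fun s hs => (hder s hs).continuousWithinAt)
      (fun s hs => (hder s (Set.Ioo_subset_Icc_self hs)).hasDerivAt (Icc_mem_nhds hs.1 hs.2))
      (ContinuousOn.intervalIntegrable (by
        rw [Set.uIcc_of_le hab]; exact hcη.inner continuousOn_const))]
    have h0 : interp t (fun j => x (t j)) a = x a := by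
      have := interp_node ht (fun j => x (t j)) 0
      rwa [ht.left] at this
    have h1 : interp t (fun j => x (t j)) b = x b := by
      have := interp_node ht (fun j => x (t j)) (Fin.last r)
      rwa [ht.right] at this
    simp [h0, h1]
  have hii : ∀ G : ℝ → Vec n, ContinuousOn G (Set.Icc a b) → IntervalIntegrable
      (fun s => inner ℝ (G s) u) MeasureTheory.volume a b := fun G hG' =>
    ContinuousOn.intervalIntegrable (by
      rw [Set.uIcc_of_le hab]; exact hG'.inner continuousOn_const)
  simp only [inner_add_left] at hinc
  rw [intervalIntegral.integral_add (hii _ hcF) (hii _ hcη), hη0, add_zero, ← hu,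
    real_inner_self_eq_norm_sq] at hinc
  set M0 := Lphi * (K * ‖e‖) + MF * (b - a) ^ (r + 1) with hM0
  -- The increment u was chosen as its own test vector; dividing by ‖u‖ bounds it.
  have hu2 : ‖u‖ * ‖u‖ ≤ ((b - a) * M0) * ‖u‖ := by
    rw [← sq, hinc]
    refine (le_abs_self _).trans ?_
    have := intervalIntegral.norm_integral_le_of_norm_le_const (a := a) (b := b)
      (f := fun s => inner ℝ (interp t c s - F s) u) (C := M0 * ‖u‖) fun s hs => by
        rw [Set.uIoc_of_le hab] at hs
        exact (norm_inner_le_norm _ _).trans (mul_le_mul_of_nonneg_right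
          (hρ0 s (Set.Ioc_subset_Icc_self hs)) (norm_nonneg _))
    rw [abs_of_nonneg hd0, Real.norm_eq_abs] at this
    linarith
  have hu1 : ‖u‖ ≤ (b - a) * M0 := by
    rcases (norm_nonneg u).eq_or_lt with h | h
    · rw [← h]; positivity
    · exact le_of_mul_le_mul_right hu2 h
  have h5 : Lphi * K * ‖e‖ ≤ Lphi * K * (2 * ‖e 0‖ + 2 * (MF * T + Mx) * (b - a) ^ (r + 1)) :=
    mul_le_mul_of_nonneg_left hsup (by positivity)
  have h6 : (b - a) * M0 ≤ (b - a) * (Lphi * K * (2 * ‖e 0‖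
      + 2 * (MF * T + Mx) * (b - a) ^ (r + 1)) + MF * (b - a) ^ (r + 1)) :=
    mul_le_mul_of_nonneg_left (by rw [hM0]; linarith) hd0
  have h7 : ‖e (Fin.last r)‖ ≤ ‖e 0‖ + ‖u‖ := norm_le_norm_add_norm_sub' _ _
  linarith

end Local

/-! ### Error at the nodes -/

section Global

variable {n m r N : ℕ} {T : ℝ} {f : Vec n → ℝ → Vec n} {B : Matrix (Fin m) (Fin n) ℝ}
  {g : ℝ → Vec m} {x0 : Vec n} {t : Fin N → Fin (r + 1) → ℝ}
  {x xd F : ℝ → Vec n} {lam : ℝ → Vec m} {Mx MF Lphi K : ℝ}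

theorem grid_succ_sub (T : ℝ) (N ℓ : ℕ) : grid T N (ℓ + 1) - grid T N ℓ = T / N := by
  simp only [grid]; push_cast; ring

theorem Icc_grid_subset (hT : 0 < T) (ℓ : Fin N) :
    Set.Icc (grid T N ℓ) (grid T N (ℓ + 1)) ⊆ Set.Icc 0 T := by
  have hN : (0 : ℝ) < N := by exact_mod_cast ℓ.pos
  refine Set.Icc_subset_Icc (by simp only [grid]; positivity) ?_
  have h1 : ((ℓ : ℕ) : ℝ) + 1 ≤ N := by exact_mod_cast ℓ.isLt
  calc grid T N (ℓ + 1) = ((ℓ : ℕ) + 1) * (T / N) := by simp only [grid]; push_cast; ring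
    _ ≤ N * (T / N) := mul_le_mul_of_nonneg_right h1 (by positivity)
    _ = T := by field_simp

/-- A discrete Gronwall inequality. -/
theorem le_of_discrete_gronwall {α : ℕ → ℝ} {κ d Q : ℝ} (hκ : 0 ≤ κ) (hd : 0 ≤ d) (hQ : 0 ≤ Q)
    (h0 : α 0 ≤ 0) (N : ℕ) (h : ∀ k, k + 1 < N → α (k + 1) ≤ (1 + κ * d) * α k + d * Q) :
    ∀ k < N, α k ≤ k * d * Q * Real.exp (κ * (k * d)) := by
  intro k
  induction k with
  | zero => intro _; simpa using h0
  | succ k ih =>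
    intro hk
    have h1 := ih (by omega)
    have hexp : (1 + κ * d) * Real.exp (κ * (k * d)) ≤ Real.exp (κ * ((k + 1 : ℕ) * d)) := by
      have h2 : Real.exp (κ * ((k + 1 : ℕ) * d)) = Real.exp (κ * d) * Real.exp (κ * (k * d)) := by
        rw [← Real.exp_add]; congr 1; push_cast; ring
      rw [h2]
      exact mul_le_mul_of_nonneg_right (by linarith [Real.add_one_le_exp (κ * d)])
        (Real.exp_nonneg _)
    have h3 : (1 : ℝ) ≤ Real.exp (κ * ((k + 1 : ℕ) * d)) := Real.one_le_exp (by positivity)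
    calc α (k + 1) ≤ (1 + κ * d) * α k + d * Q := h k hk
      _ ≤ (1 + κ * d) * (k * d * Q * Real.exp (κ * (k * d))) + d * Q * 1 := by
          rw [mul_one]
          gcongr
      _ = k * d * Q * ((1 + κ * d) * Real.exp (κ * (k * d))) + d * Q * 1 := by ring
      _ ≤ k * d * Q * Real.exp (κ * ((k + 1 : ℕ) * d))
          + d * Q * Real.exp (κ * ((k + 1 : ℕ) * d)) := by gcongr
      _ = _ := by push_cast; ring

/-- The constant in the error estimate at the nodes. -/
def nodeConst (T Lphi K Mx MF : ℝ) : ℝ :=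
  2 * (T * (2 * (Lphi * K) * (MF * T + Mx) + MF) * Real.exp (2 * (Lphi * K) * T))
    + 2 * (MF * T + Mx)

theorem nodeConst_nonneg (hT : 0 < T) (hL0 : 0 ≤ Lphi) (hK0 : 0 ≤ K) (hMx : 0 ≤ Mx)
    (hMF : 0 ≤ MF) : 0 ≤ nodeConst T Lphi K Mx MF := by
  unfold nodeConst
  positivity

/-- The scheme does not impose the constraint at `t 0`. There it is inherited from the right end
point of the preceding interval, or from the consistency of `x0`. -/
theorem IsCGSolution.constraint_all {X : Fin N → Fin (r + 1) → Vec n} {L : Fin N → Fin r → Vec m}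
    (hr : 1 ≤ r) (hX : IsCGSolution T f B g x0 t X L) (hcons : act B x0 = g 0)
    (ht : ∀ ℓ : Fin N, IsNodes (grid T N ℓ) (grid T N (ℓ + 1)) (t ℓ)) (ℓ : Fin N)
    (j : Fin (r + 1)) : act B (X ℓ j) = g (t ℓ j) := by
  have hsucc : ∀ (ℓ : Fin N) (k : Fin r), act B (X ℓ k.succ) = g (t ℓ k.succ) := fun ℓ k =>
    sub_eq_zero.1 (hX.constraint ℓ k)
  refine Fin.cases ?_ (hsucc ℓ) j
  obtain ⟨ℓ, hℓ⟩ := ℓ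
  rcases ℓ with _ | ℓ
  · rw [hX.init, hcons, (ht _).left]
    simp [grid]
  · have hℓ' : ℓ < N := by omega
    obtain ⟨r, rfl⟩ : ∃ q, r = q + 1 := ⟨r - 1, by omega⟩
    rw [hX.continuous ⟨ℓ, hℓ'⟩ hℓ, (ht _).left, ← Fin.succ_last, hsucc, Fin.succ_last,
      (ht ⟨ℓ, hℓ'⟩).right]

/-- The error at the nodes is of order `r + 1`. -/
theorem norm_node_error_le (hr : 1 ≤ r) (hT : 0 < T) (hE : IsExact r T B x xd F lam Mx MF)
    (hcons : act B x0 = g 0) (hx0 : x 0 = x0) (hgx : ∀ s ∈ Set.Icc 0 T, act B (x s) = g s)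
    (ht : ∀ ℓ : Fin N, IsNodes (grid T N ℓ) (grid T N (ℓ + 1)) (t ℓ))
    (hL : ∀ ℓ : Fin N, lebesguePhi (grid T N ℓ) (grid T N (ℓ + 1)) (t ℓ) ≤ Lphi)
    (hL0 : 0 ≤ Lphi) (hK0 : 0 ≤ K) (hsmall : T / N * (Lphi * K) ≤ 1 / 2)
    {X : Fin N → Fin (r + 1) → Vec n} {L : Fin N → Fin r → Vec m}
    (hX : IsCGSolution T f B g x0 t X L)
    (hc : ∀ ℓ j, ‖f (X ℓ j) (t ℓ j) - F (t ℓ j)‖ ≤ K * ‖X ℓ j - x (t ℓ j)‖) (ℓ : Fin N)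
    (j : Fin (r + 1)) :
    ‖X ℓ j - x (t ℓ j)‖ ≤ nodeConst T Lphi K Mx MF * (T / N) ^ (r + 1) := by
  have hN : (0 : ℝ) < N := by exact_mod_cast ℓ.pos
  have hN1 : (1 : ℝ) ≤ N := by exact_mod_cast ℓ.pos
  have hMx := hE.Mx_nonneg
  have hMF := hE.MF_nonneg
  set d := T / N with hd
  have hd0 : 0 < d := by positivity
  have hdT : d ≤ T := div_le_self hT.le hN1
  have hmemT : ∀ ℓ j, t ℓ j ∈ Set.Icc 0 T := fun ℓ j => Icc_grid_subset hT ℓ ((ht ℓ).mem j)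
  have hstep := fun ℓ : Fin N => norm_error_step_le hr hE (ht ℓ) (Icc_grid_subset hT ℓ)
    (by rw [grid_succ_sub]; exact hdT) (hL ℓ) hL0 hK0 (by rw [grid_succ_sub]; exact hsmall)
    (hX.galerkin ℓ) (fun j => by rw [hX.constraint_all hr hcons ht, hgx _ (hmemT ℓ j)]) (hc ℓ)
  simp only [grid_succ_sub, ← hd] at hstep
  -- Error at the left end point of interval k, extended by 0.
  set α : ℕ → ℝ := fun k => if hk : k < N then ‖X ⟨k, hk⟩ 0 - x (t ⟨k, hk⟩ 0)‖ else 0 with hα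
  have hα0 : α 0 ≤ 0 := by
    have hpos : 0 < N := ℓ.pos
    have h0 : t ⟨0, hpos⟩ 0 = 0 := by rw [(ht _).left]; simp [grid]
    simp [hα, hpos, hX.init hpos, h0, hx0]
  have hrec : ∀ k, k + 1 < N → α (k + 1) ≤ (1 + 2 * (Lphi * K) * d) * α k
      + d * ((2 * (Lphi * K) * (MF * T + Mx) + MF) * d ^ (r + 1)) := by
    intro k hk
    have hk' : k < N := by omega
    have h1 := (hstep ⟨k, hk'⟩).2
    have h2 : t ⟨k + 1, hk⟩ 0 = t ⟨k, hk'⟩ (Fin.last r) := by rw [(ht _).left, (ht _).right]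
    simp only [hα, hk, hk', dif_pos]
    rw [hX.continuous ⟨k, hk'⟩ hk, h2]
    exact h1
  have hgr := le_of_discrete_gronwall (by positivity) hd0.le (by positivity) hα0 N hrec ℓ ℓ.isLt
  simp only [hα, ℓ.isLt, dif_pos] at hgr
  have hℓd : (ℓ : ℕ) * d ≤ T := by
    have : ((ℓ : ℕ) : ℝ) ≤ N := by exact_mod_cast ℓ.isLt.le
    calc (ℓ : ℕ) * d ≤ N * d := mul_le_mul_of_nonneg_right this hd0.le
      _ = T := by rw [hd]; field_simp
  have hgr2 : ‖X ℓ 0 - x (t ℓ 0)‖ ≤ T * ((2 * (Lphi * K) * (MF * T + Mx) + MF) * d ^ (r + 1))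
      * Real.exp (2 * (Lphi * K) * T) := by
    refine hgr.trans ?_
    gcongr
  -- The first summand of `nodeConst` is twice the Gronwall bound at the left end point, the second
  -- comes from the one-step bound.
  refine ((hstep ℓ).1 j).trans ?_
  calc _ ≤ 2 * (T * ((2 * (Lphi * K) * (MF * T + Mx) + MF) * d ^ (r + 1))
      * Real.exp (2 * (Lphi * K) * T)) + 2 * (MF * T + Mx) * d ^ (r + 1) := by gcongr
    _ = _ := by unfold nodeConst; ring

end Global

/-! ### The multiplier -/

section Multiplier

variable {n m r : ℕ} {T a b : ℝ} {t : Fin (r + 1) → ℝ} {B : Matrix (Fin m) (Fin n) ℝ}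
  {x xd F : ℝ → Vec n} {lam : ℝ → Vec m} {Mx MF Lpsi : ℝ}
  {X c : Fin (r + 1) → Vec n} {L : Fin r → Vec m}

theorem testFn_map {p q : ℕ} (A : Vec p →L[ℝ] Vec q) (t : Fin (r + 1) → ℝ) (w : Fin r → Vec p)
    (s : ℝ) : testFn t (fun i => A (w i)) s = A (testFn t w s) := by
  simp [testFn, map_sum]

/-- Error of interpolation at the points `t 1, …, t r` for a smooth test function. -/
theorem norm_sub_testFn_le (hab : a < b) (ht : IsNodes a b t) {v : ℝ → Vec m}
    (hv : ContDiffOn ℝ ∞ v (Set.Icc a b)) {V : ℝ}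
    (hV : ∀ s ∈ Set.Icc a b, ‖iteratedDerivWithin r v (Set.Icc a b) s‖ ≤ V) {s : ℝ}
    (hs : s ∈ Set.Icc a b) : ‖v s - testFn t (fun k => v (t k.succ)) s‖ ≤ V * (b - a) ^ r := by
  have key := norm_sub_lagrange_le (fun i => iteratedDerivWithin i v (Set.Icc a b))
    (fun k : Fin r => t k.succ) (succ_injective_nodes ht) (fun k => ht.mem k.succ)
    (fun i _ s hs => hasDerivWithinAt_iteratedDerivWithin hv (uniqueDiffOn_Icc hab)
      (by exact_mod_cast ENat.natCast_lt_top i) hs) hV (Nat.zero_le r) hs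
  simpa [testFn, psi] using key

/-- Let W interpolate v at `t 1, …, t r` and let W' = Aᵀ W. Since A inverts `Bᵀ`, the sum over the L
k is ∫⟨interp t c - interpDeriv t X, W'⟩, while lam = A(F - xd). As A vanishes on the kernel of `B`,
X may be replaced by the nodal values of x inside `interpDeriv`. The pairing becomes ∫⟨lam, v - W⟩ -
∫⟨ρ, W'⟩ with ρ the defect in the error equation. -/
theorem pairing_le (hE : IsExact r T B x xd F lam Mx MF) (hab : a < b) (ht : IsNodes a b t)
    (hsub : Set.Icc a b ⊆ Set.Icc 0 T) (hL : lebesguePsi a b t ≤ Lpsi)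
    (hG : ∀ i : Fin r, ∑ j, matD a b t i j • X j - ∑ j, matM a b t i j • c j
      + act B.transpose (L i) = 0)
    (hcon : ∀ j, act B (X j) = act B (x (t j)))
    {A : Vec n →L[ℝ] Vec m} (hA : ∀ l, A (act B.transpose l) = l) (hAk : ∀ u ∈ kerB B, A u = 0)
    {Λ M0 V : ℝ} (hΛ : ∀ s ∈ Set.Icc 0 T, ‖lam s‖ ≤ Λ)
    (hM0 : ∀ s ∈ Set.Icc a b, ‖interp t c s - F s‖ ≤ M0)
    {v : ℝ → Vec m} (hv : ContDiffOn ℝ ∞ v (Set.Icc a b))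
    (hV0 : ∀ s ∈ Set.Icc a b, ‖v s‖ ≤ V)
    (hVr : ∀ s ∈ Set.Icc a b, ‖iteratedDerivWithin r v (Set.Icc a b) s‖ ≤ V) :
    pairing a b t lam L v ≤ (b - a) *
      ((Λ * (b - a) ^ r + (M0 + Mx * (b - a) ^ r) * (Lpsi * ‖A‖)) * V) := by
  have hab' := hab.le
  have hd0 : 0 ≤ b - a := by linarith
  have hMx := hE.Mx_nonneg
  have hmema : a ∈ Set.Icc a b := Set.left_mem_Icc.2 hab'
  have hVnn : 0 ≤ V := (norm_nonneg _).trans (hV0 a hmema)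
  have hΛnn : 0 ≤ Λ := (norm_nonneg _).trans (hΛ a (hsub hmema))
  have hM0nn : 0 ≤ M0 := (norm_nonneg _).trans (hM0 a hmema)
  set w : Fin r → Vec m := fun k => v (t k.succ) with hw
  set A' : Vec m →L[ℝ] Vec n := ContinuousLinearMap.adjoint A with hA'
  set w' : Fin r → Vec n := fun k => A' (w k) with hw'
  have hadj : ∀ u y, inner ℝ u (A' y) = inner ℝ (A u) y := fun u y =>
    ContinuousLinearMap.adjoint_inner_right A u y
  have hlam : ∀ s ∈ Set.Icc a b, lam s = A (F s - xd s) := fun s hs => by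
    rw [hE.ode s (hsub hs), sub_sub_cancel, hA]
  have hsum : ∑ k, inner ℝ (L k) (w k)
      = (∫ s in a..b, inner ℝ (interp t c s) (testFn t w' s))
        - ∫ s in a..b, inner ℝ (interpDeriv t X s) (testFn t w' s) := by
    rw [← sum_inner_matD, ← sum_inner_matM, ← Finset.sum_sub_distrib]
    refine Finset.sum_congr rfl fun k _ => ?_
    rw [← inner_sub_left, hadj]
    congr 1
    rw [← hA (L k)]
    congr 1
    have h := hG k
    rw [add_eq_zero_iff_eq_neg, eq_comm, neg_eq_iff_eq_neg] at h
    rw [h]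
    abel
  have hi : ∀ G : ℝ → Vec n, Continuous G → IntervalIntegrable
      (fun s => inner ℝ (G s) (testFn t w' s)) MeasureTheory.volume a b := fun G hG' =>
    (hG'.inner (continuous_testFn t w')).intervalIntegrable a b
  -- Continuity of `lam` is not a hypothesis; it follows from lam = A(F - xd).
  have hilam : IntervalIntegrable (fun s => inner ℝ (lam s) (v s)) MeasureTheory.volume a b := by
    refine ContinuousOn.intervalIntegrable ?_
    rw [Set.uIcc_of_le hab']
    refine ContinuousOn.inner (ContinuousOn.congr ?_ hlam) hv.continuousOn
    exact A.continuous.comp_continuousOn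
      ((hE.continuousOn_F.mono hsub).sub (hE.continuousOn_xd.mono hsub))
  have hpair : pairing a b t lam L v = ∫ s in a..b, (inner ℝ (lam s) (v s)
      - (inner ℝ (interp t c s) (testFn t w' s) - inner ℝ (interpDeriv t X s) (testFn t w' s))) := by
    rw [intervalIntegral.integral_sub hilam
      ((hi _ (continuous_interp t c)).sub (hi _ (continuous_interpDeriv t X))),
      intervalIntegral.integral_sub (hi _ (continuous_interp t c))
        (hi _ (continuous_interpDeriv t X)), ← hsum]
    rfl
  have hpt : ∀ s ∈ Set.Icc a b, ‖inner ℝ (lam s) (v s)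
      - (inner ℝ (interp t c s) (testFn t w' s) - inner ℝ (interpDeriv t X s) (testFn t w' s))‖
      ≤ (Λ * (b - a) ^ r + (M0 + Mx * (b - a) ^ r) * (Lpsi * ‖A‖)) * V := by
    intro s hs
    have hW' : testFn t w' s = A' (testFn t w s) := testFn_map A' t w s
    have hkill : inner ℝ (interpDeriv t (X - fun j => x (t j)) s) (testFn t w' s) = 0 := by
      rw [hW', hadj, hAk _ (interpDeriv_mem (kerB B) (fun j => ?_) s), inner_zero_left]
      rw [mem_kerB, Pi.sub_apply, act_sub, hcon, sub_self]
    have hlamW : inner ℝ (lam s) (testFn t w s) = inner ℝ (F s - xd s) (testFn t w' s) := by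
      rw [hW', hadj, ← hlam s hs]
    have hsplit : inner ℝ (lam s) (v s) - (inner ℝ (interp t c s) (testFn t w' s)
        - inner ℝ (interpDeriv t X s) (testFn t w' s))
        = inner ℝ (lam s) (v s - testFn t w s)
          - inner ℝ ((interp t c s - F s) + (xd s - interpDeriv t (fun j => x (t j)) s))
            (testFn t w' s) := by
      rw [interpDeriv_sub, inner_sub_left] at hkill
      rw [inner_sub_left] at hlamW
      simp only [inner_sub_right, inner_add_left, inner_sub_left, hlamW]
      linarith
    have hw'le : ∀ k, ‖w' k‖ ≤ ‖A‖ * V := fun k => by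
      refine (A'.le_opNorm _).trans ?_
      rw [hA', LinearIsometryEquiv.norm_map]
      exact mul_le_mul_of_nonneg_left (hV0 _ (ht.mem _)) (norm_nonneg _)
    have h1 : ‖inner ℝ (lam s) (v s - testFn t w s)‖ ≤ Λ * (V * (b - a) ^ r) :=
      (norm_inner_le_norm _ _).trans (mul_le_mul (hΛ s (hsub hs))
        (norm_sub_testFn_le hab ht hv hVr hs) (norm_nonneg _) hΛnn)
    have h2 : ‖inner ℝ ((interp t c s - F s) + (xd s - interpDeriv t (fun j => x (t j)) s))
        (testFn t w' s)‖ ≤ (M0 + Mx * (b - a) ^ r) * (Lpsi * (‖A‖ * V)) :=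
      (norm_inner_le_norm _ _).trans (mul_le_mul
        ((norm_add_le _ _).trans (add_le_add (hM0 s hs) (hE.interp_xd a b t ht hsub s hs)))
        (norm_testFn_le hL (by positivity) hw'le hs) (norm_nonneg _) (by positivity))
    rw [hsplit]
    refine (norm_sub_le _ _).trans ((add_le_add h1 h2).trans (le_of_eq ?_))
    ring
  rw [hpair]
  have hfin := intervalIntegral.norm_integral_le_of_norm_le_const (a := a) (b := b)
    fun s hs => hpt s (Set.Ioc_subset_Icc_self (by rwa [Set.uIoc_of_le hab'] at hs))
  rw [abs_of_nonneg hd0, mul_comm] at hfin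
  exact (le_abs_self _).trans hfin

theorem norm_le_of_ckNorm_le {k : ℕ∞} {v : ℝ → Vec m} {V : ℝ} (hV0 : 0 ≤ V)
    (hV : ckNorm k a b v ≤ ENNReal.ofReal V) {j : ℕ} (hj : (j : ℕ∞) ≤ k) {s : ℝ}
    (hs : s ∈ Set.Icc a b) : ‖iteratedDerivWithin j v (Set.Icc a b) s‖ ≤ V := by
  have h : ‖iteratedDerivWithin j v (Set.Icc a b) s‖ₑ ≤ ckNorm k a b v :=
    le_iSup₂_of_le j hj (le_iSup₂_of_le s hs le_rfl)
  rw [← ofReal_norm] at h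
  exact (ENNReal.ofReal_le_ofReal_iff hV0).1 (h.trans hV)

/-- A bound of the pairing by `C * V` for all test functions with `C^k` norm at most `V` bounds
the dual norm. -/
theorem dualNorm_le_ofReal {k : ℕ∞} {C : ℝ} (hC : 0 ≤ C)
    (h : ∀ (v : ℝ → Vec m) (V : ℝ), ContDiffOn ℝ ∞ v (Set.Icc a b) →
      (∀ j : ℕ, (j : ℕ∞) ≤ k → ∀ s ∈ Set.Icc a b, ‖iteratedDerivWithin j v (Set.Icc a b) s‖ ≤ V) →
      pairing a b t lam L v ≤ C * V) :
    dualNorm k a b t lam L ≤ ENNReal.ofReal C := by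
  refine iSup_le fun v => iSup_le fun hv => iSup_le fun _ => ?_
  by_cases htop : ckNorm k a b v = ⊤
  · simp [htop]
  · refine ENNReal.div_le_of_le_mul ?_
    have hle : ckNorm k a b v ≤ ENNReal.ofReal (ckNorm k a b v).toReal :=
      (ENNReal.ofReal_toReal htop).ge
    have hp := h v (ckNorm k a b v).toReal hv fun j hj s hs =>
      norm_le_of_ckNorm_le ENNReal.toReal_nonneg hle hj hs
    calc ENNReal.ofReal (pairing a b t lam L v)
        ≤ ENNReal.ofReal (C * (ckNorm k a b v).toReal) := ENNReal.ofReal_le_ofReal hp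
      _ = ENNReal.ofReal C * ckNorm k a b v := by
          rw [ENNReal.ofReal_mul hC, ENNReal.ofReal_toReal htop]

/-- Only v and its derivative of order r enter the bound on the pairing, so every C^k norm with k ≥
r controls it. -/
theorem dualNorm_le (hE : IsExact r T B x xd F lam Mx MF) (hab : a < b)
    (ht : IsNodes a b t) (hsub : Set.Icc a b ⊆ Set.Icc 0 T) (hbT : b - a ≤ T)
    (hL : lebesguePsi a b t ≤ Lpsi) (hL0 : 0 ≤ Lpsi)
    (hG : ∀ i : Fin r, ∑ j, matD a b t i j • X j - ∑ j, matM a b t i j • c j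
      + act B.transpose (L i) = 0)
    (hcon : ∀ j, act B (X j) = act B (x (t j)))
    {A : Vec n →L[ℝ] Vec m} (hA : ∀ l, A (act B.transpose l) = l) (hAk : ∀ u ∈ kerB B, A u = 0)
    {Λ M0 : ℝ} (hM0nn : 0 ≤ M0) (hΛ : ∀ s ∈ Set.Icc 0 T, ‖lam s‖ ≤ Λ)
    (hM0 : ∀ s ∈ Set.Icc a b, ‖interp t c s - F s‖ ≤ M0 * (b - a) ^ (r + 1))
    {k : ℕ∞} (hk : (r : ℕ∞) ≤ k) :
    dualNorm k a b t lam L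
      ≤ ENNReal.ofReal ((Λ + (M0 * T + Mx) * (Lpsi * ‖A‖)) * (b - a) ^ (r + 1)) := by
  have hd0 : 0 ≤ b - a := by linarith
  have hT0 : 0 ≤ T := hd0.trans hbT
  have hMx := hE.Mx_nonneg
  have hmema : a ∈ Set.Icc a b := Set.left_mem_Icc.2 hab.le
  have hΛnn : 0 ≤ Λ := (norm_nonneg _).trans (hΛ a (hsub hmema))
  refine dualNorm_le_ofReal (by positivity) fun v V hv hV => ?_
  have hV0 : ∀ s ∈ Set.Icc a b, ‖v s‖ ≤ V := fun s hs => by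
    simpa using hV 0 (by simp) s hs
  have hVnn : 0 ≤ V := (norm_nonneg _).trans (hV0 a hmema)
  refine (pairing_le hE hab ht hsub hL hG hcon hA hAk hΛ hM0 hv hV0 (hV r hk)).trans ?_
  have h1 : M0 * (b - a) ^ (r + 1) ≤ M0 * T * (b - a) ^ r := by
    rw [pow_succ, mul_assoc, mul_comm T, ← mul_assoc, ← mul_assoc]
    exact mul_le_mul_of_nonneg_left hbT (by positivity)
  calc _ ≤ (b - a) * ((Λ * (b - a) ^ r + (M0 * T * (b - a) ^ r + Mx * (b - a) ^ r)
        * (Lpsi * ‖A‖)) * V) := by gcongr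
    _ = _ := by ring

end Multiplier

/-! ### Lipschitz continuity of the right hand side -/

section Lipschitz

variable {n r : ℕ} {T : ℝ} {f : Vec n → ℝ → Vec n}

theorem exists_lipschitzOnWith_closedBall
    (hf : ContDiffOn ℝ (r + 1) (fun p : Vec n × ℝ => f p.1 p.2) (Set.univ ×ˢ Set.Icc 0 T))
    (R : ℝ) : ∃ K : NNReal, ∀ s ∈ Set.Icc 0 T,
      LipschitzOnWith K (fun u => f u s) (Metric.closedBall 0 R) := by
  have hsub : Metric.closedBall (0 : Vec n) R ×ˢ Set.Icc 0 T ⊆ Set.univ ×ˢ Set.Icc 0 T :=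
    Set.prod_mono (Set.subset_univ _) subset_rfl
  obtain ⟨K, hK⟩ := (hf.mono hsub).exists_lipschitzOnWith (by simp)
    ((convex_closedBall _ _).prod (convex_Icc 0 T))
    ((isCompact_closedBall _ _).prod isCompact_Icc)
  refine ⟨K, fun s hs u hu v hv => ?_⟩
  simpa [Prod.edist_eq] using hK (x := (u, s)) ⟨hu, hs⟩ (y := (v, s)) ⟨hv, hs⟩

/-- Outside a ball, `f` can be changed so that it becomes Lipschitz in space. -/
theorem exists_lipschitz_extension
    (hf : ContDiffOn ℝ (r + 1) (fun p : Vec n × ℝ => f p.1 p.2) (Set.univ ×ˢ Set.Icc 0 T))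
    (R : ℝ) : ∃ (K : ℝ) (F : Vec n → ℝ → Vec n), 0 ≤ K ∧
      (∀ s ∈ Set.Icc 0 T, ∀ u v, ‖F u s - F v s‖ ≤ K * ‖u - v‖) ∧
      ∀ s ∈ Set.Icc 0 T, ∀ u, ‖u‖ ≤ R → F u s = f u s := by
  obtain ⟨K, hK⟩ := exists_lipschitzOnWith_closedBall hf R
  -- Each time slice is extended separately; the scheme evaluates f at single times, so no
  -- regularity in time is needed.
  choose! F hF hFf using fun s hs => (hK s hs).extend_finite_dimension
  refine ⟨lipschitzExtensionConstant (Vec n) * K, fun u s => F s u, by positivity,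
    fun s hs u v => ?_, fun s hs u hu => ?_⟩
  · simpa [dist_eq_norm] using (hF s hs).dist_le_mul u v
  · exact (hFf s hs (by simpa using hu)).symm

end Lipschitz

theorem IsCGSolution.congr {n m r N : ℕ} {T : ℝ} {f f' : Vec n → ℝ → Vec n}
    {B : Matrix (Fin m) (Fin n) ℝ} {g : ℝ → Vec m} {x0 : Vec n} {t : Fin N → Fin (r + 1) → ℝ}
    {X : Fin N → Fin (r + 1) → Vec n} {L : Fin N → Fin r → Vec m}
    (h : IsCGSolution T f B g x0 t X L)
    (hff : ∀ ℓ j, f' (X ℓ j) (t ℓ j) = f (X ℓ j) (t ℓ j)) : IsCGSolution T f' B g x0 t X L :=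
  ⟨h.init, h.continuous, fun ℓ i => by simpa only [hff] using h.galerkin ℓ i, h.constraint⟩

theorem exists_pos_forall_le_mul_le (c : ℝ) {η : ℝ} (hη : 0 < η) :
    ∃ δ : ℝ, 0 < δ ∧ ∀ d, 0 ≤ d → d ≤ δ → d * c ≤ η := by
  refine ⟨η / (|c| + 1), by positivity, fun d hd hdδ => ?_⟩
  rw [le_div_iff₀ (by positivity)] at hdδ
  nlinarith [le_abs_self c]

end

end CGDAE

/-! ### Proof of the theorem: truncation of f and two passes of the error estimate -/

theorem mainTheorem1 {n m r : ℕ} (hr : 1 ≤ r) (T : ℝ) (hT : 0 < T)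
    (f : CGDAE.Vec n → ℝ → CGDAE.Vec n)
    (hf : ContDiffOn ℝ (r + 1) (fun p : CGDAE.Vec n × ℝ => f p.1 p.2)
      (Set.univ ×ˢ Set.Icc 0 T))
    (B : Matrix (Fin m) (Fin n) ℝ) (hB : B.rank = m)
    (g : ℝ → CGDAE.Vec m) (hg : ContDiffOn ℝ (r + 2) g (Set.Icc 0 T))
    (x0 : CGDAE.Vec n) (hcons : CGDAE.act B x0 = g 0)
    (x : ℝ → CGDAE.Vec n) (lam : ℝ → CGDAE.Vec m)
    (hsol : CGDAE.IsDAESolution T f B g x0 x lam)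
    (hx : ContDiffOn ℝ (r + 1) x (Set.Icc 0 T))
    (Lphi Lpsi : ℝ) :
    ∃ C : ℝ, 0 < C ∧ ∀ R : ℝ, (∀ s ∈ Set.Icc 0 T, ‖x s‖ < R) →
      ∃ Δ₀ : ℝ, 0 < Δ₀ ∧ ∀ N : ℕ, 0 < N → T / N ≤ Δ₀ →
        ∀ t : Fin N → Fin (r + 1) → ℝ,
          (∀ ℓ : Fin N, CGDAE.IsNodes (CGDAE.grid T N ℓ) (CGDAE.grid T N (ℓ + 1)) (t ℓ) ∧
            CGDAE.lebesguePhi (CGDAE.grid T N ℓ) (CGDAE.grid T N (ℓ + 1)) (t ℓ) ≤ Lphi ∧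
            CGDAE.lebesguePsi (CGDAE.grid T N ℓ) (CGDAE.grid T N (ℓ + 1)) (t ℓ) ≤ Lpsi) →
          (∃! p : (Fin N → Fin (r + 1) → CGDAE.Vec n) × (Fin N → Fin r → CGDAE.Vec m),
            CGDAE.IsCGSolution T f B g x0 t p.1 p.2 ∧ ∀ ℓ j, ‖p.1 ℓ j‖ ≤ R) ∧
          ∀ (X : Fin N → Fin (r + 1) → CGDAE.Vec n) (L : Fin N → Fin r → CGDAE.Vec m),
            CGDAE.IsCGSolution T f B g x0 t X L → (∀ ℓ j, ‖X ℓ j‖ ≤ R) →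
            (∀ ℓ : Fin N, ∀ s ∈ Set.Icc (CGDAE.grid T N ℓ) (CGDAE.grid T N (ℓ + 1)),
              ‖x s - CGDAE.interp (t ℓ) (X ℓ) s‖ ≤ C * (T / N) ^ (r + 1)) ∧
            (∀ ℓ : Fin N, ∀ k : ℕ∞, (r : ℕ∞) ≤ k →
              CGDAE.dualNorm k (CGDAE.grid T N ℓ) (CGDAE.grid T N (ℓ + 1)) (t ℓ) lam (L ℓ)
                ≤ ENNReal.ofReal (C * (T / N) ^ (r + 1))) := by
  open CGDAE in
  obtain ⟨Mx, MF, hE⟩ := exists_isExact hT hf hsol hx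
  obtain ⟨A, hA, hAk⟩ := exists_leftInverse_act_transpose hB
  have hMx := hE.Mx_nonneg
  have hMF := hE.MF_nonneg
  have hne : (Set.Icc 0 T).Nonempty := ⟨0, Set.left_mem_Icc.2 hT.le⟩
  obtain ⟨Λ, hΛ⟩ : ∃ Λ, ∀ s ∈ Set.Icc 0 T, ‖lam s‖ ≤ Λ := by
    obtain ⟨Λ, hΛ⟩ := isCompact_Icc.exists_bound_of_continuousOn
      (A.continuous.comp_continuousOn (hE.continuousOn_F.sub hE.continuousOn_xd))
    refine ⟨Λ, fun s hs => ?_⟩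
    have h := hΛ s hs
    simp only [Function.comp_apply, Pi.sub_apply, hE.ode s hs, sub_sub_cancel, hA] at h
    exact h
  have hΛ0 : 0 ≤ Λ := (norm_nonneg _).trans (hΛ 0 (Set.left_mem_Icc.2 hT.le))
  obtain ⟨sm, hsm, hmax⟩ := isCompact_Icc.exists_isMaxOn hne hx.continuousOn.norm
  have hgx : ∀ s ∈ Set.Icc 0 T, act B (x s) = g s := fun s hs =>
    sub_eq_zero.1 (hsol.constraint s hs)
  -- This radius does not depend on R, so neither do `K₀` and the final constant.
  obtain ⟨K₀, hK₀⟩ := exists_lipschitzOnWith_closedBall hf (‖x sm‖ + 1)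
  set Lp := max Lphi 0 with hLp
  set Lq := max Lpsi 0 with hLq
  have hLp0 : 0 ≤ Lp := le_max_right _ _
  have hLq0 : 0 ≤ Lq := le_max_right _ _
  have hCn0 : 0 ≤ nodeConst T Lp K₀ Mx MF := nodeConst_nonneg hT hLp0 K₀.coe_nonneg hMx hMF
  set Cn := nodeConst T Lp K₀ Mx MF with hCn
  set M0 := Lp * (K₀ * Cn) + MF with hM0
  have hM00 : 0 ≤ M0 := by positivity
  set Cx := Mx + Lp * Cn with hCx
  set Cl := Λ + (M0 * T + Mx) * (Lq * ‖A‖) with hCl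
  have hCx0 : 0 ≤ Cx := by positivity
  have hCl0 : 0 ≤ Cl := by positivity
  refine ⟨Cx + Cl + 1, by positivity, fun R hR => ?_⟩
  obtain ⟨K, f', hK0, hK, hff'⟩ := exists_lipschitz_extension hf R
  -- An error below this gap keeps the discrete states in both balls, of radius R and of radius ‖x
  -- sm‖ + 1.
  have hgap : 0 < min (R - ‖x sm‖) 1 := lt_min (sub_pos.2 (hR sm hsm)) one_pos
  obtain ⟨δ₁, hδ₁, hsmall₁⟩ := exists_pos_forall_le_mul_le (Lp * K) one_half_pos
  obtain ⟨δ₂, hδ₂, hsmall₂⟩ := exists_pos_forall_le_mul_le (Lp * K₀) one_half_pos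
  obtain ⟨δ₃, hδ₃, hsmall₃⟩ := exists_pos_forall_le_mul_le (nodeConst T Lp K Mx MF) hgap
  -- δ₁ and δ₂ give the smallness conditions for K and `K₀`, δ₃ keeps the error below the gap, and
  -- the bound 1 gives Δ^(r+1) ≤ Δ.
  refine ⟨min (min δ₁ δ₂) (min δ₃ 1), by positivity, fun N hN hNΔ t hnodes => ?_⟩
  have hN' : (0 : ℝ) < N := by exact_mod_cast hN
  have hd0 : 0 < T / N := by positivity
  have hdT : T / N ≤ T := div_le_self hT.le (by exact_mod_cast hN)
  simp only [le_min_iff] at hNΔ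
  obtain ⟨⟨hd₁, hd₂⟩, hd₃, hd₄⟩ := hNΔ
  have ht := fun ℓ => (hnodes ℓ).1
  have hLphi : ∀ ℓ : Fin N, lebesguePhi (grid T N ℓ) (grid T N (ℓ + 1)) (t ℓ) ≤ Lp :=
    fun ℓ => (hnodes ℓ).2.1.trans (le_max_left Lphi 0)
  have hLpsi : ∀ ℓ : Fin N, lebesguePsi (grid T N ℓ) (grid T N (ℓ + 1)) (t ℓ) ≤ Lq :=
    fun ℓ => (hnodes ℓ).2.2.trans (le_max_left Lpsi 0)
  have htT : ∀ ℓ j, t ℓ j ∈ Set.Icc 0 T := fun ℓ j => Icc_grid_subset hT ℓ ((ht ℓ).mem j)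
  have hs₁ := hsmall₁ _ hd0.le hd₁
  have hs₂ := hsmall₂ _ hd0.le hd₂
  -- Every solution of the modified scheme is close to the exact solution.
  have hclose : ∀ X L, IsCGSolution T f' B g x0 t X L → ∀ ℓ j,
      ‖X ℓ j - x (t ℓ j)‖ ≤ min (R - ‖x sm‖) 1 := by
    intro X L hX ℓ j
    refine (norm_node_error_le hr hT hE hcons hsol.init hgx ht hLphi hLp0 hK0 hs₁ hX
      (fun ℓ j => ?_) ℓ j).trans ?_
    · rw [← hff' _ (htT ℓ j) _ (hR _ (htT ℓ j)).le]
      exact hK _ (htT ℓ j) _ _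
    · have h1 : (T / N) ^ (r + 1) ≤ T / N := pow_le_of_le_one hd0.le hd₄ (by omega)
      have h2 := hsmall₃ _ hd0.le hd₃
      rw [mul_comm]
      exact (mul_le_mul_of_nonneg_right h1 (nodeConst_nonneg hT hLp0 hK0 hMx hMF)).trans h2
  have hto : ∀ X L, IsCGSolution T f B g x0 t X L → (∀ ℓ j, ‖X ℓ j‖ ≤ R) →
      IsCGSolution T f' B g x0 t X L := fun X L hX hXR =>
    hX.congr fun ℓ j => hff' _ (htT ℓ j) _ (hXR ℓ j)
  have hnorm : ∀ X L, IsCGSolution T f' B g x0 t X L → ∀ ℓ j,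
      ‖X ℓ j‖ ≤ R ∧ ‖X ℓ j‖ ≤ ‖x sm‖ + 1 := by
    intro X L hX ℓ j
    have h1 := hclose X L hX ℓ j
    rw [le_min_iff] at h1
    have h2 : ‖x (t ℓ j)‖ ≤ ‖x sm‖ := hmax (htT ℓ j)
    have h3 := norm_le_norm_add_norm_sub' (X ℓ j) (x (t ℓ j))
    exact ⟨by linarith, by linarith⟩
  refine ⟨?_, fun X L hX hXR => ?_⟩
  · obtain ⟨X, L, hX⟩ := exists_isCGSolution_of_isStep (f := f') (B := B) (g := g) (x0 := x0)
      (t := t) fun ℓ y => exists_isStep (ht ℓ) hB (hLphi ℓ) hK0 (fun j => hK _ (htT ℓ j))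
        (by rw [grid_succ_sub]; exact hs₁) y
    refine ⟨(X, L), ⟨hX.congr fun ℓ j => (hff' _ (htT ℓ j) _ (hnorm X L hX ℓ j).1).symm,
      fun ℓ j => (hnorm X L hX ℓ j).1⟩, ?_⟩
    rintro ⟨X', L'⟩ ⟨hX', hXR'⟩
    have hX'' := hto X' L' hX' hXR'
    have := hX''.unique hX fun ℓ h0 => (hX''.isStep ℓ).unique (ht ℓ) hB (hLphi ℓ)
      (by rw [grid_succ_sub]; exact hs₁) (h0 ▸ hX.isStep ℓ) (fun j => hK _ (htT ℓ j) _ _) hK0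
    exact Prod.ext this.1 this.2
  · have hXn := hnorm X L (hto X L hX hXR)
    have hLip : ∀ ℓ j, ‖f (X ℓ j) (t ℓ j) - f (x (t ℓ j)) (t ℓ j)‖
        ≤ K₀ * ‖X ℓ j - x (t ℓ j)‖ := fun ℓ j => by
      have hxm : ‖x (t ℓ j)‖ ≤ ‖x sm‖ := hmax (htT ℓ j)
      simpa [dist_eq_norm] using (hK₀ _ (htT ℓ j)).dist_le_mul (X ℓ j)
        (by simpa using (hXn ℓ j).2) (x (t ℓ j))
        (by rw [mem_closedBall_zero_iff]; linarith)
    -- Second pass, for the original f with `K₀` in place of the R-dependent K.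
    have herr := norm_node_error_le hr hT hE hcons hsol.init hgx ht hLphi hLp0 K₀.coe_nonneg hs₂ hX hLip
    have hpow : 0 ≤ (T / N) ^ (r + 1) := by positivity
    refine ⟨fun ℓ s hs => ?_, fun ℓ k hk => ?_⟩
    · have h1 := hE.interp_x _ _ _ (ht ℓ) (Icc_grid_subset hT ℓ) s hs
      have h2 := norm_interp_le (x := X ℓ - fun j => x (t ℓ j)) (hLphi ℓ) (herr ℓ) hs
      rw [grid_succ_sub] at h1
      rw [interp_sub] at h2
      calc ‖x s - interp (t ℓ) (X ℓ) s‖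
          = ‖(x s - interp (t ℓ) (fun j => x (t ℓ j)) s)
            - (interp (t ℓ) (X ℓ) s - interp (t ℓ) (fun j => x (t ℓ j)) s)‖ := by
            congr 1; abel
        _ ≤ Mx * (T / N) ^ (r + 1) + Lp * (Cn * (T / N) ^ (r + 1)) :=
            (norm_sub_le _ _).trans (add_le_add h1 h2)
        _ = Cx * (T / N) ^ (r + 1) := by rw [hCx]; ring
        _ ≤ (Cx + Cl + 1) * (T / N) ^ (r + 1) :=
            mul_le_mul_of_nonneg_right (by linarith) hpow
    · have hlt : grid T N ℓ < grid T N (ℓ + 1) := by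
        rw [← sub_pos, grid_succ_sub]; exact hd0
      have h1 := dualNorm_le hE hlt (ht ℓ) (Icc_grid_subset hT ℓ)
        (by rw [grid_succ_sub]; exact hdT) (hLpsi ℓ) hLq0 (hX.galerkin ℓ)
        (fun j => by rw [hX.constraint_all hr hcons ht, hgx _ (htT ℓ j)]) hA hAk hM00 hΛ
        (fun s hs => by
          refine (norm_interp_sub_rhs_le hE (ht ℓ) (Icc_grid_subset hT ℓ) (hLphi ℓ) K₀.coe_nonneg
            (hLip ℓ) (herr ℓ) hs).trans (le_of_eq ?_)
          rw [grid_succ_sub, hM0, hCn]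
          ring) hk
      rw [grid_succ_sub] at h1
      refine h1.trans (ENNReal.ofReal_le_ofReal ?_)
      exact mul_le_mul_of_nonneg_right (by linarith) hpow
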